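/- Let $q\in\mathbb{C}$ with $0<|q|<1$, choose $\tau\in\mathbb{C}$ with $\operatorname{Im}\tau>0$ and $q=e^{2\pi i\tau}$, and put $q^{\lambda}:=e^{2\pi i\lambda\tau}$. Let $K=\mathbb{C}(\{z\})$ be the field of convergent Laurent series with the automorphism $\phi(z)=qz$, and for $n\ge 1$ let $K_n=\mathbb{C}(\{z^{1/n}\})\supseteq K$ with $\phi(z^{1/n})=q^{1/n}z^{1/n}$. A difference module over $K$ is a finite dimensional $K$-vector space $M$ with an additive bijection $\Phi:M\to M$ such that $\Phi(fm)=\phi(f)\Phi(m)$ for $f\in K$, $m\in M$; it is irreducible if $M\neq 0$ and $0$, $M$ are its only difference submodules. The slopes of $M$ are those of the Newton polygon (with respect to the order $v$ at $z=0$) of any monic operator $L=\Phi^m+\dots+a_1\Phi+a_0$, $a_0\ne0$, with $M\cong K[\Phi,\Phi^{-1}]/K[\Phi,\Phi^{-1}]L$, the sign being normalised so that $\Phi-a$ has slope $v(a)$; $M$ is pure if it has exactly one slope. For $n\ge1$, $t\in\mathbb{Z}$ with $\gcd(t,n)=1$, and $c\in\mathbb{C}^*$ with $|q|^{1/n}<|c|\le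 1$, let $E(cz^{t/n})$ be the one-dimensional difference module $K_ne$, $\Phi e=cz^{t/n}e$, over $K_n$, considered as a difference module over $K$. Then: 1. Every $E(cz^{t/n})$ is pure, irreducible and has slope $t/n$. 2. For fixed $t/n$ and $c_1,c_2$ as above, $E(c_1z^{t/n})\cong E(c_2z^{t/n})$ if and only if $c_1^n=c_2^n$. 3. Every irreducible difference module over $K$ is isomorphic to some $E(cz^{t/n})$ with $n,t,c$ as above. -/

import Mathlib

universe u v

noncomputable section

namespace QDiff

/-- A formal Laurent series over `ℂ` (its principal part is finite by definition) is convergent if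
it converges absolutely on some punctured disc around `0`. -/
def IsConvergent (f : LaurentSeries ℂ) : Prop :=
  ∃ r : ℝ, 0 < r ∧ Summable fun k : ℤ => ‖f.coeff k‖ * r ^ k

theorem IsConvergent.exists_forall {f : LaurentSeries ℂ} (hf : IsConvergent f) :
    ∃ r₀ : ℝ, 0 < r₀ ∧ ∀ r : ℝ, 0 < r → r ≤ r₀ → Summable fun k : ℤ => ‖f.coeff k‖ * r ^ k := by
  obtain ⟨r₀, h0, hs⟩ := hf
  refine ⟨r₀, h0, fun r hr hle => ?_⟩
  refine Summable.of_nonneg_of_le (fun k => by positivity) (fun k => ?_)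
    (hs.mul_right ((r / r₀) ^ f.order))
  by_cases hk : k < f.order
  · simp [HahnSeries.coeff_eq_zero_of_lt_order hk]
  · have h1 : (r / r₀) ^ k ≤ (r / r₀) ^ f.order :=
      zpow_le_zpow_right_of_le_one₀ (by positivity) ((div_le_one h0).2 hle) (not_lt.1 hk)
    have h2 : r ^ k = r₀ ^ k * (r / r₀) ^ k := by
      rw [← mul_zpow, mul_div_cancel₀ _ h0.ne']
    rw [h2, ← mul_assoc]
    exact mul_le_mul_of_nonneg_left h1 (by positivity)

theorem IsConvergent.single (m : ℤ) (a : ℂ) : IsConvergent (HahnSeries.single m a) := by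
  refine ⟨1, one_pos, summable_of_ne_finset_zero (s := {m}) fun k hk => ?_⟩
  rw [HahnSeries.coeff_single_of_ne (by simpa using hk)]
  simp

theorem IsConvergent.add {f g : LaurentSeries ℂ} (hf : IsConvergent f) (hg : IsConvergent g) :
    IsConvergent (f + g) := by
  obtain ⟨r, hr, hf⟩ := hf.exists_forall
  obtain ⟨s, hs, hg⟩ := hg.exists_forall
  have h0 : 0 < min r s := lt_min hr hs
  refine ⟨min r s, h0, Summable.of_nonneg_of_le (fun k => by positivity) (fun k => ?_)
    ((hf _ h0 (min_le_left _ _)).add (hg _ h0 (min_le_right _ _)))⟩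
  rw [← add_mul]
  exact mul_le_mul_of_nonneg_right (by simpa using norm_add_le _ _) (by positivity)

theorem IsConvergent.neg {f : LaurentSeries ℂ} (hf : IsConvergent f) : IsConvergent (-f) := by
  obtain ⟨r, hr, hf⟩ := hf
  exact ⟨r, hr, by simpa using hf⟩

theorem IsConvergent.mul {f g : LaurentSeries ℂ} (hf : IsConvergent f) (hg : IsConvergent g) :
    IsConvergent (f * g) := by
  obtain ⟨r, hr, hf⟩ := hf.exists_forall
  obtain ⟨s, hs, hg⟩ := hg.exists_forall
  have h0 : 0 < min r s := lt_min hr hs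
  replace hf := hf _ h0 (min_le_left _ _)
  replace hg := hg _ h0 (min_le_right _ _)
  set ρ := min r s
  have hF := hf.mul_of_nonneg hg (fun k => by positivity) (fun k => by positivity)
  have hn : ∀ x : ℤ × ℤ, 0 ≤ ‖f.coeff x.1‖ * ρ ^ x.1 * (‖g.coeff x.2‖ * ρ ^ x.2) :=
    fun x => by positivity
  refine ⟨ρ, h0, Summable.of_nonneg_of_le (fun k => by positivity) (fun k => ?_)
    (summable_of_sum_le (f := fun k : ℤ => ∑ x ∈ Finset.antidiagonal f.isPWO_support
      g.isPWO_support k, ‖f.coeff x.1‖ * ρ ^ x.1 * (‖g.coeff x.2‖ * ρ ^ x.2))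
      (c := ∑' x : ℤ × ℤ, ‖f.coeff x.1‖ * ρ ^ x.1 * (‖g.coeff x.2‖ * ρ ^ x.2))
      (fun k => Finset.sum_nonneg fun x _ => hn x) fun u => ?_)⟩
  · rw [HahnSeries.coeff_mul]
    refine (mul_le_mul_of_nonneg_right (norm_sum_le _ _) (by positivity)).trans ?_
    rw [Finset.sum_mul]
    refine Finset.sum_le_sum fun x hx => le_of_eq ?_
    have hx' : x.1 + x.2 = k := by
      simp only [Finset.mem_antidiagonal] at hx
      exact hx.2.2
    rw [← hx', zpow_add₀ h0.ne', norm_mul]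
    ring
  · rw [← Finset.sum_biUnion]
    · exact hF.sum_le_tsum _ fun x _ => hn x
    · intro k _ l _ hkl
      refine Finset.disjoint_left.2 fun x hx hx' => hkl ?_
      simp only [Finset.mem_antidiagonal] at hx hx'
      exact hx.2.2.symm.trans hx'.2.2


theorem IsConvergent.inv {f : LaurentSeries ℂ} (hf : IsConvergent f) : IsConvergent f⁻¹ := by
  by_cases h0 : f = 0
  · subst h0
    simpa using hf
  obtain ⟨r, hr, hs⟩ := hf
  set u : PowerSeries ℂ := f.powerSeriesPart with hu
  have hu0 : PowerSeries.constantCoeff u ≠ 0 := by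
    rw [← PowerSeries.coeff_zero_eq_constantCoeff_apply, hu, LaurentSeries.powerSeriesPart_coeff]
    simpa using HahnSeries.coeff_order_eq_zero.not.2 h0
  set a : ℂ := (PowerSeries.constantCoeff u)⁻¹ with ha
  have hfac : f⁻¹ = HahnSeries.single (-f.order) 1 * HahnSeries.ofPowerSeries ℤ ℂ u⁻¹ := by
    refine inv_eq_of_mul_eq_one_right ?_
    have h1 : (HahnSeries.ofPowerSeries ℤ ℂ u) * HahnSeries.ofPowerSeries ℤ ℂ u⁻¹ = 1 := by
      rw [← map_mul, PowerSeries.mul_inv_cancel _ hu0, map_one]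
    rw [hu, LaurentSeries.ofPowerSeries_powerSeriesPart] at h1
    rw [← h1]
    ring
  rw [hfac]
  refine (IsConvergent.single _ _).mul ?_
  -- the coefficients of `u` are bounded by a geometric progression
  obtain ⟨C, hC, hb⟩ : ∃ C : ℝ, 0 ≤ C ∧ ∀ k : ℕ, ‖a‖ * ‖PowerSeries.coeff k u‖ ≤ C * r⁻¹ ^ k := by
    refine ⟨‖a‖ * (r ^ (-f.order) * ∑' k : ℤ, ‖f.coeff k‖ * r ^ k), ?_, fun k => ?_⟩
    · have : 0 ≤ ∑' k : ℤ, ‖f.coeff k‖ * r ^ k := tsum_nonneg fun k => by positivity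
      positivity
    · have h1 := hs.le_tsum (f.order + k) (fun j _ => by positivity)
      rw [hu, LaurentSeries.powerSeriesPart_coeff, mul_assoc]
      refine mul_le_mul_of_nonneg_left ?_ (norm_nonneg _)
      have h2 : ‖f.coeff (f.order + k)‖ =
          r ^ (-f.order) * (‖f.coeff (f.order + k)‖ * r ^ (f.order + (k : ℤ))) * r⁻¹ ^ k := by
        rw [zpow_add₀ hr.ne', zpow_neg, zpow_natCast, inv_pow]
        field_simp
      rw [h2]
      gcongr
  set B : ℝ := r⁻¹ * (1 + C) with hB
  have hB0 : 0 < B := by positivity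
  have key : ∀ k : ℕ, ‖PowerSeries.coeff k u⁻¹‖ ≤ ‖a‖ * B ^ k := by
    intro k
    induction k using Nat.strong_induction_on with
    | _ k ih =>
      rw [PowerSeries.coeff_inv]
      split_ifs with hk
      · subst hk
        simp [ha]
      · rw [norm_mul, norm_neg]
        refine (mul_le_mul_of_nonneg_left (norm_sum_le _ _) (norm_nonneg _)).trans ?_
        rw [Finset.mul_sum, Finset.Nat.sum_antidiagonal_eq_sum_range_succ_mk, Finset.sum_range_succ']
        have hz : ‖(PowerSeries.constantCoeff u)⁻¹‖ * ‖if k - 0 < k then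
            (PowerSeries.coeff 0) u * (PowerSeries.coeff (k - 0)) u⁻¹ else 0‖ = 0 := by simp
        simp only [] at hz ⊢
        rw [hz, add_zero]
        have hstep : ∀ i ∈ Finset.range k, ‖(PowerSeries.constantCoeff u)⁻¹‖ *
            ‖if k - (i + 1) < k then (PowerSeries.coeff (i + 1)) u *
              (PowerSeries.coeff (k - (i + 1))) u⁻¹ else 0‖ ≤
            ‖a‖ * (r⁻¹ ^ k * (C * (1 + C) ^ (k - 1 - i))) := by
          intro i hi
          have hik : i < k := Finset.mem_range.1 hi
          rw [if_pos (by omega), norm_mul, ← mul_assoc, ← ha]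
          calc _ ≤ (C * r⁻¹ ^ (i + 1)) * (‖a‖ * B ^ (k - (i + 1))) :=
                mul_le_mul (hb _) (ih _ (by omega)) (norm_nonneg _) (by positivity)
            _ = _ := by
                have e : k = (i + 1) + (k - (i + 1)) := by omega
                have e' : k - 1 - i = k - (i + 1) := by omega
                rw [hB, mul_pow, e']
                conv_rhs => rw [e, pow_add]
                simp only [Nat.add_sub_cancel_left]
                ring
        refine (Finset.sum_le_sum hstep).trans ?_
        rw [← Finset.mul_sum, ← Finset.mul_sum, ← Finset.mul_sum,
          Finset.sum_range_reflect (fun j => (1 + C) ^ j) k]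
        have hg : C * ∑ j ∈ Finset.range k, (1 + C) ^ j = (1 + C) ^ k - 1 := by
          have := mul_geom_sum (1 + C) k
          simpa using this
        rw [hg, hB, mul_pow]
        gcongr
        linarith
  refine ⟨(2 * B)⁻¹, by positivity, ?_⟩
  have hinj : Function.Injective (fun k : ℕ => (k : ℤ)) := Nat.cast_injective
  rw [← hinj.summable_iff]
  · refine Summable.of_nonneg_of_le (fun k => mul_nonneg (norm_nonneg _) (zpow_nonneg (by positivity) _)) (fun k => ?_)
      ((summable_geometric_of_lt_one (r := (1 / 2 : ℝ)) (by norm_num) (by norm_num)).mul_left ‖a‖)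
    simp only [Function.comp, HahnSeries.ofPowerSeries_apply_coeff, zpow_natCast]
    have hB2 : 0 < (2 * B)⁻¹ := by positivity
    calc _ ≤ ‖a‖ * B ^ k * (2 * B)⁻¹ ^ k := by gcongr; exact key k
      _ = _ := by
        rw [mul_assoc, ← mul_pow]
        congr 2
        field_simp
  · intro k hk
    have : (HahnSeries.ofPowerSeries ℤ ℂ u⁻¹).coeff k = 0 := by
      rw [HahnSeries.ofPowerSeries_apply]
      refine HahnSeries.embDomain_of_notMem_range ?_
      rintro ⟨j, rfl⟩
      exact hk ⟨j, rfl⟩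
    rw [this]
    simp

/-- The field `K = ℂ({z})` of convergent Laurent series. -/
def ConvLaurent : Subfield (LaurentSeries ℂ) where
  carrier := {f | IsConvergent f}
  mul_mem' := IsConvergent.mul
  one_mem' := IsConvergent.single 0 1
  add_mem' := IsConvergent.add
  zero_mem' := by simpa using IsConvergent.single 0 0
  neg_mem' := IsConvergent.neg
  inv_mem' := fun _ h => IsConvergent.inv h

/-- The series `c z ^ t`. -/
def mono (t : ℤ) (c : ℂ) : ConvLaurent := ⟨HahnSeries.single t c, IsConvergent.single t c⟩

theorem mono_ne_zero (t : ℤ) (c : ℂˣ) : mono t c ≠ 0 := fun h =>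
  c.ne_zero (HahnSeries.single_eq_zero_iff.1 (congrArg Subtype.val h))

/-- The substitution `f(z) ↦ f(a z)` on formal Laurent series, for `a ≠ 0`. -/
def formalDilation (a : ℂˣ) : LaurentSeries ℂ →+* LaurentSeries ℂ where
  toFun f := ⟨fun k => (a : ℂ) ^ k * f.coeff k,
    f.isPWO_support.mono fun k hk h => hk (by simp [h])⟩
  map_one' := by
    ext k
    by_cases hk : k = 0 <;> simp [hk]
  map_zero' := by
    ext k
    simp
  map_add' f g := by
    ext k
    simp [mul_add]
  map_mul' f g := by
    ext k
    simp only [HahnSeries.coeff_mul, Finset.mul_sum]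
    refine Finset.sum_congr ?_ fun x hx => ?_
    · ext x
      simp [zpow_ne_zero _ a.ne_zero]
    · have hx' : x.1 + x.2 = k := by
        simp only [Finset.mem_antidiagonal] at hx
        exact hx.2.2
      rw [← hx', zpow_add₀ a.ne_zero]
      ring

theorem IsConvergent.dilation (a : ℂˣ) {f : LaurentSeries ℂ} (hf : IsConvergent f) :
    IsConvergent (formalDilation a f) := by
  obtain ⟨r, hr, hs⟩ := hf
  have ha : 0 < ‖(a : ℂ)‖ := norm_pos_iff.2 a.ne_zero
  refine ⟨r / ‖(a : ℂ)‖, by positivity, hs.congr fun k => ?_⟩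
  simp only [formalDilation, RingHom.coe_mk, MonoidHom.coe_mk, OneHom.coe_mk, norm_mul, norm_zpow,
    div_zpow]
  field_simp

/-- The automorphism `f(z) ↦ f(a z)` of `K = ℂ({z})`, for `a ≠ 0`. -/
def dilation (a : ℂˣ) : ConvLaurent ≃+* ConvLaurent where
  toFun f := ⟨formalDilation a f.1, f.2.dilation a⟩
  invFun f := ⟨formalDilation a⁻¹ f.1, f.2.dilation a⁻¹⟩
  left_inv f := by
    ext k
    simp [formalDilation, zpow_ne_zero _ a.ne_zero]
  right_inv f := by
    ext k
    simp [formalDilation, zpow_ne_zero _ a.ne_zero]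
  map_mul' f g := Subtype.ext (map_mul (formalDilation a) f.1 g.1)
  map_add' f g := Subtype.ext (map_add (formalDilation a) f.1 g.1)

/-- The substitution `f(z) ↦ f(w ^ n)` from formal Laurent series in `z` to those in `w`. -/
def formalRamification (n : ℕ) [NeZero n] : LaurentSeries ℂ →+* LaurentSeries ℂ :=
  HahnSeries.embDomainRingHom (AddMonoidHom.mulLeft (n : ℤ))
    (mul_right_injective₀ (Nat.cast_ne_zero.2 (NeZero.ne n)))
    (fun _ _ => mul_le_mul_iff_right₀ (Nat.cast_pos.2 (NeZero.pos n)))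

theorem formalRamification_coeff_mul (n : ℕ) [NeZero n] (f : LaurentSeries ℂ) (k : ℤ) :
    (formalRamification n f).coeff (n * k) = f.coeff k :=
  HahnSeries.embDomain_mk_coeff _ _

theorem formalRamification_coeff_of_not_dvd (n : ℕ) [NeZero n] (f : LaurentSeries ℂ) {k : ℤ}
    (hk : ¬ (n : ℤ) ∣ k) : (formalRamification n f).coeff k = 0 := by
  refine HahnSeries.embDomain_of_notMem_range ?_
  rintro ⟨j, rfl⟩
  exact hk ⟨j, rfl⟩

theorem IsConvergent.ramification (n : ℕ) [NeZero n] {f : LaurentSeries ℂ} (hf : IsConvergent f) :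
    IsConvergent (formalRamification n f) := by
  obtain ⟨r, hr, hs⟩ := hf
  have hinj : Function.Injective (fun k : ℤ => (n : ℤ) * k) :=
    mul_right_injective₀ (Nat.cast_ne_zero.2 (NeZero.ne n))
  refine ⟨r ^ ((n : ℝ)⁻¹), by positivity, ?_⟩
  rw [← hinj.summable_iff]
  · refine hs.congr fun k => ?_
    simp only [Function.comp, formalRamification_coeff_mul]
    rw [zpow_mul, zpow_natCast, Real.rpow_inv_natCast_pow hr.le (NeZero.ne n)]
  · intro k hk
    rw [formalRamification_coeff_of_not_dvd n f fun ⟨j, hj⟩ => hk ⟨j, hj.symm⟩]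
    simp

/-- The field `K_n = ℂ({z^{1/n}})`: convergent Laurent series in the variable `w = z^{1/n}`. -/
def KRoot (_n : ℕ) : Type := ConvLaurent

instance (n : ℕ) : Field (KRoot n) := inferInstanceAs (Field ConvLaurent)

/-- The identification of `ℂ({w})` with `K_n` coming from `w = z^{1/n}`. -/
def KRoot.equiv (n : ℕ) : ConvLaurent ≃+* KRoot n := RingEquiv.refl ConvLaurent

/-- The element `c z^{t/n} = c w ^ t` of `K_n`. -/
def rootMono (n : ℕ) (t : ℤ) (c : ℂ) : KRoot n := KRoot.equiv n (mono t c)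

/-- The inclusion `K → K_n`, `z ↦ w ^ n`. -/
def ramification (n : ℕ) [NeZero n] : ConvLaurent →+* KRoot n where
  toFun f := KRoot.equiv n ⟨formalRamification n f.1, f.2.ramification n⟩
  map_one' := Subtype.ext (map_one (formalRamification n))
  map_zero' := Subtype.ext (map_zero (formalRamification n))
  map_mul' f g := Subtype.ext (map_mul (formalRamification n) f.1 g.1)
  map_add' f g := Subtype.ext (map_add (formalRamification n) f.1 g.1)

instance (n : ℕ) [NeZero n] : Algebra ConvLaurent (KRoot n) :=
  (ramification n).toAlgebra

/-- `q^λ := e^{2πiλτ}`. -/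
def qPow (τ l : ℂ) : ℂˣ :=
  Units.mk0 (Complex.exp (2 * Real.pi * Complex.I * l * τ)) (Complex.exp_ne_zero _)

/-- The automorphism `φ` of `K_n` with `φ (z^{1/n}) = q^{1/n} z^{1/n}`. -/
def rootShift (τ : ℂ) (n : ℕ) : KRoot n ≃+* KRoot n :=
  ((KRoot.equiv n).symm.trans (dilation (qPow τ (1 / n)))).trans (KRoot.equiv n)

/-- On `K ⊆ K_n` the automorphism `φ` of `K_n` is `z ↦ q z`. -/
theorem rootShift_algebraMap {q : ℂˣ} {τ : ℂ}
    (hqτ : (q : ℂ) = Complex.exp (2 * Real.pi * Complex.I * τ)) (n : ℕ) [NeZero n]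
    (f : ConvLaurent) :
    rootShift τ n (algebraMap ConvLaurent (KRoot n) f) =
      algebraMap ConvLaurent (KRoot n) (dilation q f) := by
  have hq : (qPow τ (1 / n) : ℂ) ^ n = q := by
    have hn : (n : ℂ) ≠ 0 := Nat.cast_ne_zero.2 (NeZero.ne n)
    rw [hqτ, qPow, Units.val_mk0, ← Complex.exp_nat_mul]
    congr 1
    field_simp
  refine Subtype.ext (HahnSeries.ext (funext fun k => ?_))
  change (qPow τ (1 / n) : ℂ) ^ k * (formalRamification n f.1).coeff k =
    (formalRamification n (formalDilation q f.1)).coeff k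
  by_cases hk : (n : ℤ) ∣ k
  · obtain ⟨j, rfl⟩ := hk
    rw [formalRamification_coeff_mul, formalRamification_coeff_mul, zpow_mul, zpow_natCast, hq]
    rfl
  · rw [formalRamification_coeff_of_not_dvd n _ hk, formalRamification_coeff_of_not_dvd n _ hk,
      mul_zero]

/-- The convergent series `∑ k, f_{nk + i} z ^ k` attached to a convergent series `f`. -/
def residuePart (n : ℕ) [NeZero n] (i : ℕ) (f : ConvLaurent) : ConvLaurent :=
  ⟨HahnSeries.ofSuppBddBelow (fun k : ℤ => f.1.coeff (n * k + i)) (by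
    refine ⟨-(|f.1.order| + i), fun k hk => ?_⟩
    by_contra hlt
    refine hk (HahnSeries.coeff_eq_zero_of_lt_order ?_)
    have hn : (1 : ℤ) ≤ n := by exact_mod_cast NeZero.pos n
    have h1 := neg_abs_le f.1.order
    have h2 := abs_nonneg f.1.order
    have h3 : (0 : ℤ) ≤ i := by positivity
    nlinarith), by
    obtain ⟨r, hr, hs⟩ := f.2
    refine ⟨r ^ n, by positivity, ?_⟩
    have hinj : Function.Injective (fun k : ℤ => (n : ℤ) * k + i) := fun a b h =>
      mul_right_injective₀ (Nat.cast_ne_zero.2 (NeZero.ne n)) (add_right_cancel h)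
    refine ((hs.comp_injective hinj).mul_right (r ^ (-(i : ℤ)))).congr fun k => ?_
    simp only [Function.comp, HahnSeries.ofSuppBddBelow]
    rw [mul_assoc, ← zpow_add₀ hr.ne', add_neg_cancel_right, zpow_mul, zpow_natCast]⟩

/-- `K_n` is finite over `K`, spanned by `1, w, …, w ^ (n - 1)`. -/
instance (n : ℕ) [NeZero n] : Module.Finite ConvLaurent (KRoot n) := by
  refine Module.Finite.of_surjective
    (Fintype.linearCombination ConvLaurent (fun i : Fin n => rootMono n (i : ℕ) 1))
    fun f => ?_
  obtain ⟨f, rfl⟩ := (KRoot.equiv n).surjective f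
  refine ⟨fun i => residuePart n i f, ?_⟩
  rw [Fintype.linearCombination_apply]
  refine (KRoot.equiv n).symm.injective (Subtype.ext (HahnSeries.ext (funext fun k => ?_)))
  rw [map_sum, RingEquiv.symm_apply_apply]
  have hval : ∀ g : Fin n → ConvLaurent, (∑ i, g i).1 = ∑ i, (g i).1 := fun g =>
    map_sum ConvLaurent.subtype g Finset.univ
  rw [hval, HahnSeries.coeff_sum]
  have hterm : ∀ i : Fin n,
      ((KRoot.equiv n).symm (residuePart n i f • rootMono n (i : ℕ) 1)).1.coeff k =
      (formalRamification n (residuePart n i f).1).coeff (k - (i : ℕ)) := by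
    intro i
    have := HahnSeries.coeff_mul_single_add (r := (1 : ℂ))
      (x := formalRamification n (residuePart n i f).1) (a := k - (i : ℕ)) (b := ((i : ℕ) : ℤ))
    rw [sub_add_cancel, mul_one] at this
    exact this
  simp only [hterm]
  have hn : (0 : ℤ) < n := by exact_mod_cast NeZero.pos n
  have hm0 := Int.emod_nonneg k hn.ne'
  have hm1 := Int.emod_lt_of_pos k hn
  set i₀ : Fin n := ⟨(k % n).toNat, by omega⟩ with hi₀
  have hi₀' : ((i₀ : ℕ) : ℤ) = k % n := by simp [hi₀, hm0]
  rw [Finset.sum_eq_single i₀]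
  · have e : k - ((i₀ : ℕ) : ℤ) = n * (k / n) := by
      have := Int.mul_ediv_add_emod k n
      omega
    rw [e, formalRamification_coeff_mul]
    change f.1.coeff (n * (k / n) + ((i₀ : ℕ) : ℤ)) = _
    rw [← e, sub_add_cancel]
  · intro i _ hi
    refine formalRamification_coeff_of_not_dvd n _ fun hd => hi (Fin.ext ?_)
    have h1 : k % n = ((i : ℕ) : ℤ) % n := Int.emod_eq_emod_iff_emod_sub_eq_zero.2
      (Int.emod_eq_zero_of_dvd hd)
    have h2 : ((i : ℕ) : ℤ) % n = i := Int.emod_eq_of_lt (by positivity) (by exact_mod_cast i.2)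
    rw [h2] at h1
    omega
  · simp

/-! ### Difference modules over a difference field `(F, φ)` -/

/-- A difference module over the difference field `(F, φ)`: a finite dimensional vector space with
an additive bijection `Φ` such that `Φ (f m) = φ(f) Φ(m)`. -/
structure DifferenceModule {F : Type*} [Field F] (φ : F ≃+* F) where
  carrier : Type u
  [addCommGroup : AddCommGroup carrier]
  [module : Module F carrier]
  [finite : Module.Finite F carrier]
  Φ : carrier ≃+ carrier
  Φ_smul : ∀ (f : F) (m : carrier), Φ (f • m) = φ f • Φ m

attribute [instance] DifferenceModule.addCommGroup DifferenceModule.module DifferenceModule.finite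

namespace DifferenceModule

variable {F : Type*} [Field F] {φ : F ≃+* F}

/-- Two difference modules are isomorphic if there is a linear bijection commuting with `Φ`. -/
def Isomorphic (M : DifferenceModule.{u} φ) (N : DifferenceModule.{v} φ) : Prop :=
  ∃ e : M.carrier ≃ₗ[F] N.carrier, ∀ m, e (M.Φ m) = N.Φ (e m)

/-- A difference module is irreducible if it is nonzero and its only difference submodules
(subspaces `N` with `Φ(N) = N`) are `0` and itself. -/
def IsIrreducible (M : DifferenceModule.{u} φ) : Prop :=
  Nontrivial M.carrier ∧
    ∀ N : Submodule F M.carrier, (∀ m, M.Φ m ∈ N ↔ m ∈ N) → N = ⊥ ∨ N = ⊤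

end DifferenceModule

/-- The skew ring `F[Φ, Φ⁻¹]` of difference operators: finite sums `∑ aₖ Φ ^ k`, `k ∈ ℤ`, with
`Φ f = φ(f) Φ`. It is the skew group ring of `ℤ` for the action of `ℤ` on `F` by powers of `φ`. -/
def DiffOp {F : Type*} [Field F] (_φ : F ≃+* F) : Type _ :=
  SkewMonoidAlgebra F (Multiplicative ℤ)

namespace DiffOp

variable {F : Type*} [Field F] (φ : F ≃+* F)

/-- The action of `ℤ` (written multiplicatively) on `F` by the powers of `φ`. -/
abbrev zAction : MulSemiringAction (Multiplicative ℤ) F :=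
  MulSemiringAction.compHom F (zpowersHom (RingAut F) φ)

instance : Ring (DiffOp φ) :=
  letI := zAction φ
  inferInstanceAs (Ring (SkewMonoidAlgebra F (Multiplicative ℤ)))

/-- The operator `a Φ ^ k`. -/
def term (k : ℤ) (a : F) : DiffOp φ := SkewMonoidAlgebra.single (Multiplicative.ofAdd k) a

theorem term_mul_term (k l : ℤ) (a b : F) :
    term φ k a * term φ l b = term φ (k + l) (a * (φ ^ k : RingAut F) b) := by
  let _ := zAction φ
  exact SkewMonoidAlgebra.single_mul_single

/-- The operator `∑ aᵢ Φ ^ i` with the coefficients of the polynomial `∑ aᵢ T ^ i`. -/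
def ofPolynomial (p : Polynomial F) : DiffOp φ :=
  ∑ i ∈ p.support, term φ i (p.coeff i)

end DiffOp

namespace DifferenceModule

variable {F : Type*} [Field F] {φ : F ≃+* F}

/-- `M ≅ F[Φ, Φ⁻¹] / F[Φ, Φ⁻¹] L`: an additive bijection compatible with the scalars from `F`
and with `Φ`. The span is that of a left module, so it is the left ideal generated by `L`. -/
def IsPresentedBy (M : DifferenceModule.{u} φ) (L : DiffOp φ) : Prop :=
  ∃ e : (DiffOp φ ⧸ Submodule.span (DiffOp φ) {L}) ≃+ M.carrier,
    (∀ (f : F) x, e (DiffOp.term φ 0 f • x) = f • e x) ∧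
    ∀ x, e (DiffOp.term φ 1 1 • x) = M.Φ (e x)

end DifferenceModule

/-! ### Newton polygons and slopes over `K` -/

/-- The Newton polygon of `∑ aᵢ T ^ i ∈ K[T]`: the convex hull of the vertical half-lines above the
points `(i, v(aᵢ))` with `aᵢ ≠ 0`, where `v` is the order at `z = 0`. -/
def newtonPolygon (p : Polynomial ConvLaurent) : Set (ℝ × ℝ) :=
  convexHull ℝ {x | ∃ i : ℕ, p.coeff i ≠ 0 ∧ x.1 = i ∧ (((p.coeff i).1.order : ℤ) : ℝ) ≤ x.2}

/-- `l` is a slope of the Newton polygon of `p` if a non-vertical edge of it (more than one point)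
lies on a line `y + l x = b`. The sign is normalised so that `T - a` has slope `v(a)`; thus the
module `K e`, `Φ e = c z ^ t e`, has slope `t`. -/
def IsNewtonSlope (p : Polynomial ConvLaurent) (l : ℝ) : Prop :=
  ∃ b : ℝ, (∀ x ∈ newtonPolygon p, b ≤ x.2 + l * x.1) ∧
    {x ∈ newtonPolygon p | x.2 + l * x.1 = b}.Nontrivial

namespace DifferenceModule

variable {φ : ConvLaurent ≃+* ConvLaurent}

/-- The slopes of `M`: those of the Newton polygons of the monic operators
`L = Φ ^ m + ⋯ + a₁ Φ + a₀`, `a₀ ≠ 0`, with `M ≅ K[Φ, Φ⁻¹] / K[Φ, Φ⁻¹] L`. -/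
def slopes (M : DifferenceModule.{u} φ) : Set ℝ :=
  {l | ∃ p : Polynomial ConvLaurent, p.Monic ∧ p.coeff 0 ≠ 0 ∧
    M.IsPresentedBy (DiffOp.ofPolynomial φ p) ∧ IsNewtonSlope p l}

/-- `M` is pure if it has exactly one slope. -/
def IsPure (M : DifferenceModule.{u} φ) : Prop := ∃ l, M.slopes = {l}

end DifferenceModule

/-- The difference module `E(c z^{t/n})` over `K`, where `φ` is `z ↦ q z` with `q = e^{2πiτ}`: the
one-dimensional module `K_n e`, `Φ e = c z^{t/n} e`, over `K_n`, considered over `K`. The element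
`f e` is represented by `f`, so that `Φ f = φ(f) c z^{t/n}`. -/
def E (q : ℂˣ) (τ : ℂ) (hqτ : (q : ℂ) = Complex.exp (2 * Real.pi * Complex.I * τ))
    (n : ℕ) [NeZero n] (t : ℤ) (c : ℂˣ) : DifferenceModule.{0} (dilation q) where
  carrier := KRoot n
  Φ := (rootShift τ n).toAddEquiv.trans (AddAut.mulRight
    (Units.mk0 (rootMono n t c) (mono_ne_zero t c)))
  Φ_smul f m := by
    change rootShift τ n (f • m) * rootMono n t c = dilation q f • (rootShift τ n m * rootMono n t c)
    rw [Algebra.smul_def, map_mul, rootShift_algebraMap hqτ, Algebra.smul_def, mul_assoc]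

/-- The conditions on the data `(n, t, c)` of a module `E(c z^{t/n})`, besides `n ≥ 1` and `c ≠ 0`:
`(t, n) = 1` and `|q|^{1/n} < |c| ≤ 1`. -/
def IsAdmissible (q : ℂˣ) (n : ℕ) (t : ℤ) (c : ℂˣ) : Prop :=
  IsCoprime t (n : ℤ) ∧ ‖(q : ℂ)‖ ^ (1 / (n : ℝ)) < ‖(c : ℂ)‖ ∧ ‖(c : ℂ)‖ ≤ 1

end QDiff

end

/-!
A difference module is a module over `K[Φ, Φ⁻¹]`, where one can divide with remainder by a monic
operator with nonzero constant term. Hence the annihilator of a vector is generated by such an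
operator, and an operator of degree at most the dimension kills the vector.

In `E(c z^{t/n})` the operator `a Φ ^ i` with `a ∈ K` changes the order in `z^{1/n}` by an element
of `n ℤ + t i`. As `t` is prime to `n`, the vectors `f, Φ f, …, Φ ^ (n - 1) f` have distinct orders
modulo `n`, which gives irreducibility, and in an operator of degree `n` killing `f` only the two
extreme terms can have the same order, which gives the slope.

Conversely, a nonzero vector of an irreducible module is killed by some `∑ aᵢ Φ ^ i`. Take `t / n`
to be the first slope of its Newton polygon and solve the equation in `E(c z^{t/n})` by Frobenius'
method: the coefficient of `z^{k/n}` is found by dividing by the value of the characteristic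
polynomial at `c q^{k/n}`. If `c` is a root of minimal modulus, none of these values with `k > 0`
vanishes, and they tend to a nonzero limit, so that the solution converges. It defines a nonzero map
between irreducible modules.
-/

noncomputable section

namespace QDiff

/-! ### Convergent solutions of `q`-difference equations -/

section PowerSeries

variable {𝕜 : Type*} [NormedField 𝕜]

/-- The sequence with first term `1` given by the linear recursion `f k = ∑ l < k, u k l * f l`. -/
def recursiveSeq (u : ℕ → ℕ → 𝕜) : ℕ → 𝕜
  | 0 => 1
  | k + 1 => ∑ l : Fin (k + 1), u (k + 1) l * recursiveSeq u l

theorem recursiveSeq_zero (u : ℕ → ℕ → 𝕜) : recursiveSeq u 0 = 1 := by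
  rw [recursiveSeq]

theorem recursiveSeq_of_pos (u : ℕ → ℕ → 𝕜) {k : ℕ} (hk : 0 < k) :
    recursiveSeq u k = ∑ l ∈ Finset.range k, u k l * recursiveSeq u l := by
  obtain ⟨k, rfl⟩ := Nat.exists_eq_add_of_lt hk
  rw [Nat.zero_add, recursiveSeq, Finset.sum_range]

theorem norm_recursiveSeq_le {u : ℕ → ℕ → 𝕜} {C R : ℝ} (hC : 0 ≤ C) (hR : 0 ≤ R)
    (hu : ∀ k l, l < k → ‖u k l‖ ≤ C * R ^ (k - l)) (k : ℕ) :
    ‖recursiveSeq u k‖ ≤ (R * (1 + C)) ^ k := by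
  induction k using Nat.strong_induction_on with
  | _ k ih =>
    rcases Nat.eq_zero_or_pos k with rfl | hk
    · simp [recursiveSeq_zero]
    have hterm : ∀ l ∈ Finset.range k,
        ‖u k l * recursiveSeq u l‖ ≤ R ^ k * (C * (1 + C) ^ l) := fun l hl => by
      have hlk := Finset.mem_range.1 hl
      calc ‖u k l * recursiveSeq u l‖ ≤ C * R ^ (k - l) * (R * (1 + C)) ^ l := by
            rw [norm_mul]
            exact mul_le_mul (hu k l hlk) (ih l hlk) (norm_nonneg _) (by positivity)
        _ = R ^ k * (C * (1 + C) ^ l) := by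
            rw [mul_pow, ← pow_sub_mul_pow R hlk.le]
            ring
    calc ‖recursiveSeq u k‖ ≤ ∑ l ∈ Finset.range k, R ^ k * (C * (1 + C) ^ l) := by
          rw [recursiveSeq_of_pos u hk]
          exact norm_sum_le_of_le _ hterm
      _ = R ^ k * ((1 + C) ^ k - 1) := by
          rw [← Finset.mul_sum, ← Finset.mul_sum, ← mul_geom_sum (1 + C) k, add_sub_cancel_left]
      _ ≤ (R * (1 + C)) ^ k := by
          rw [mul_pow]
          gcongr
          linarith

theorem exists_solution_of_triangular {T : ℕ → ℕ → 𝕜} {C R : ℝ} (hC : 0 ≤ C) (hR : 0 ≤ R)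
    (h0 : T 0 0 = 0) (hdiag : ∀ k, 0 < k → T k k ≠ 0)
    (hle : ∀ k l, l < k → ‖T k l / T k k‖ ≤ C * R ^ (k - l)) :
    ∃ f : ℕ → 𝕜, f 0 = 1 ∧ (∀ k, ‖f k‖ ≤ (R * (1 + C)) ^ k) ∧
      ∀ k, ∑ l ∈ Finset.range (k + 1), T k l * f l = 0 := by
  set u : ℕ → ℕ → 𝕜 := fun k l => -(T k l / T k k) with hu
  refine ⟨recursiveSeq u, recursiveSeq_zero u,
    norm_recursiveSeq_le hC hR fun k l hl => by simpa only [hu, norm_neg] using hle k l hl,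
    fun k => ?_⟩
  rcases Nat.eq_zero_or_pos k with rfl | hk
  · simp [h0]
  · have hne := hdiag k hk
    rw [Finset.sum_range_succ, recursiveSeq_of_pos u hk, Finset.mul_sum, ← Finset.sum_add_distrib]
    refine Finset.sum_eq_zero fun l _ => ?_
    simp only [hu]
    field_simp
    ring

theorem exists_norm_inv_eval_le {P : Polynomial 𝕜} {p : 𝕜} (hp : ‖p‖ < 1) (c : 𝕜)
    (h0 : P.eval 0 ≠ 0) : ∃ D : ℝ, 0 ≤ D ∧ ∀ k : ℕ, ‖(P.eval (c * p ^ k))⁻¹‖ ≤ D := by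
  have hlim : Filter.Tendsto (fun k : ℕ => (P.eval (c * p ^ k))⁻¹) Filter.atTop
      (nhds (P.eval 0)⁻¹) := by
    refine ((P.continuous.tendsto 0).comp ?_).inv₀ h0
    simpa using (tendsto_pow_atTop_nhds_zero_of_norm_lt_one hp).const_mul c
  obtain ⟨D, hD⟩ := (Metric.isBounded_range_of_tendsto _ hlim).exists_norm_le
  exact ⟨D, (norm_nonneg _).trans (hD _ ⟨0, rfl⟩), fun k => hD _ ⟨k, rfl⟩⟩

/-- The characteristic polynomial at `z = 0` of the operator `∑ i ∈ s, b i * σ ^ i`. -/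
def charPoly (s : Finset ℕ) (b : ℕ → PowerSeries 𝕜) : Polynomial 𝕜 :=
  ∑ i ∈ s, Polynomial.monomial i (PowerSeries.constantCoeff (b i))

theorem charPoly_eval (s : Finset ℕ) (b : ℕ → PowerSeries 𝕜) (x : 𝕜) :
    (charPoly s b).eval x = ∑ i ∈ s, PowerSeries.constantCoeff (b i) * x ^ i := by
  simp [charPoly, Polynomial.eval_finsetSum]

theorem charPoly_coeff {s : Finset ℕ} (b : ℕ → PowerSeries 𝕜) {i : ℕ} (hi : i ∈ s) :
    (charPoly s b).coeff i = PowerSeries.constantCoeff (b i) := by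
  simp [charPoly, Polynomial.coeff_monomial, hi]

theorem coeff_sum_mul_rescale (s : Finset ℕ) (b : ℕ → PowerSeries 𝕜) (c p : 𝕜)
    (F : PowerSeries 𝕜) (k : ℕ) :
    PowerSeries.coeff k (∑ i ∈ s, b i * (PowerSeries.C (c ^ i) * PowerSeries.rescale (p ^ i) F)) =
      ∑ l ∈ Finset.range (k + 1), (∑ i ∈ s, PowerSeries.coeff (k - l) (b i) * (c * p ^ l) ^ i) *
        PowerSeries.coeff l F := by
  simp only [map_sum, Finset.sum_mul]
  rw [Finset.sum_comm]
  refine Finset.sum_congr rfl fun i _ => ?_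
  rw [mul_comm, PowerSeries.coeff_mul, Finset.Nat.sum_antidiagonal_eq_sum_range_succ_mk]
  refine Finset.sum_congr rfl fun l _ => ?_
  rw [PowerSeries.coeff_C_mul, PowerSeries.coeff_rescale]
  ring

/-- Comparing the coefficients of `z ^ k` gives a recursion whose diagonal entries are the values
of the characteristic polynomial at `c p ^ k`; these stay away from `0` because `c p ^ k → 0`. -/
theorem exists_rescale_solution {p c : 𝕜} (hp : ‖p‖ < 1) (s : Finset ℕ)
    {b : ℕ → PowerSeries 𝕜} {A R : ℝ} (hA : 0 ≤ A) (hR : 0 ≤ R)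
    (hb : ∀ i ∈ s, ∀ k, ‖PowerSeries.coeff k (b i)‖ ≤ A * R ^ k)
    (h0 : (charPoly s b).eval 0 ≠ 0) (hc : (charPoly s b).eval c = 0)
    (hroot : ∀ k : ℕ, 0 < k → (charPoly s b).eval (c * p ^ k) ≠ 0) :
    ∃ F : PowerSeries 𝕜, PowerSeries.coeff 0 F = 1 ∧
      (∃ B : ℝ, ∀ k, ‖PowerSeries.coeff k F‖ ≤ B ^ k) ∧
      ∑ i ∈ s, b i * (PowerSeries.C (c ^ i) * PowerSeries.rescale (p ^ i) F) = 0 := by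
  obtain ⟨D, hD, hDle⟩ := exists_norm_inv_eval_le hp c h0
  set T : ℕ → ℕ → 𝕜 := fun k l => ∑ i ∈ s, PowerSeries.coeff (k - l) (b i) * (c * p ^ l) ^ i
  have hdiag : ∀ k, T k k = (charPoly s b).eval (c * p ^ k) := fun k => by
    simp only [T, charPoly_eval, Nat.sub_self, PowerSeries.coeff_zero_eq_constantCoeff_apply]
  set C : ℝ := ∑ i ∈ s, A * ‖c‖ ^ i
  have hC : 0 ≤ C := Finset.sum_nonneg fun i _ => by positivity
  have hT : ∀ k l, ‖T k l‖ ≤ C * R ^ (k - l) := fun k l => by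
    rw [Finset.sum_mul]
    refine norm_sum_le_of_le _ fun i hi => ?_
    have hpl : ‖c * p ^ l‖ ≤ ‖c‖ := by
      rw [norm_mul, norm_pow]
      exact mul_le_of_le_one_right (norm_nonneg _) (pow_le_one₀ (norm_nonneg _) hp.le)
    calc _ ≤ A * R ^ (k - l) * ‖c‖ ^ i := by
          rw [norm_mul, norm_pow]
          exact mul_le_mul (hb i hi _) (pow_le_pow_left₀ (norm_nonneg _) hpl i) (by positivity)
            (by positivity)
      _ = A * ‖c‖ ^ i * R ^ (k - l) := by ring
  obtain ⟨f, hf0, hf, hTf⟩ := exists_solution_of_triangular (T := T) (mul_nonneg hC hD) hR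
    (by rw [hdiag, pow_zero, mul_one, hc]) (fun k hk => by rw [hdiag]; exact hroot k hk)
    fun k l _ => by
      rw [div_eq_mul_inv, norm_mul, hdiag, mul_right_comm]
      exact mul_le_mul (hT k l) (hDle k) (norm_nonneg _) (by positivity)
  refine ⟨PowerSeries.mk f, by rw [PowerSeries.coeff_mk, hf0], ⟨_, fun k => by
    rw [PowerSeries.coeff_mk]; exact hf k⟩, ?_⟩
  ext k
  simp only [coeff_sum_mul_rescale, PowerSeries.coeff_mk, map_zero]
  exact hTf k

end PowerSeries

theorem IsConvergent.exists_coeff_bound {f : LaurentSeries ℂ} (hf : IsConvergent f) :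
    ∃ A R : ℝ, 0 ≤ A ∧ 0 ≤ R ∧ ∀ k : ℕ, ‖f.coeff k‖ ≤ A * R ^ k := by
  obtain ⟨r, hr, hs⟩ := hf
  refine ⟨∑' k : ℤ, ‖f.coeff k‖ * r ^ k, r⁻¹, tsum_nonneg fun k => by positivity,
    by positivity, fun k => ?_⟩
  have h1 := hs.le_tsum (k : ℤ) (fun j _ => by positivity)
  rw [inv_pow, ← div_eq_mul_inv, le_div_iff₀ (by positivity)]
  simpa using h1

theorem exists_uniform_coeff_bound (s : Finset ℕ) (b : ℕ → ConvLaurent) :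
    ∃ A R : ℝ, 0 ≤ A ∧ 0 ≤ R ∧ ∀ i ∈ s, ∀ k : ℕ, ‖(b i).1.coeff k‖ ≤ A * R ^ k := by
  choose A R hA hR h using fun i => (b i).2.exists_coeff_bound
  refine ⟨∑ i ∈ s, A i, ∑ i ∈ s, R i, Finset.sum_nonneg fun i _ => hA i,
    Finset.sum_nonneg fun i _ => hR i, fun i hi k => (h i k).trans ?_⟩
  have h1 := Finset.single_le_sum (fun j _ => hA j) hi
  have h2 := Finset.single_le_sum (fun j _ => hR j) hi
  exact mul_le_mul h1 (pow_le_pow_left₀ (hR i) h2 k) (pow_nonneg (hR i) k)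
    (Finset.sum_nonneg fun i _ => hA i)

theorem IsConvergent.ofPowerSeries {F : PowerSeries ℂ} {B : ℝ}
    (h : ∀ k, ‖PowerSeries.coeff k F‖ ≤ B ^ k) :
    IsConvergent (HahnSeries.ofPowerSeries ℤ ℂ F) := by
  set r : ℝ := (2 * (|B| + 1))⁻¹ with hr
  have hr0 : 0 < r := by positivity
  have hBr : |B * r| ≤ 1 / 2 := by
    rw [abs_mul, abs_of_pos hr0, hr, mul_inv_le_iff₀ (by positivity)]
    linarith
  refine ⟨r, hr0, (Nat.cast_injective.summable_iff fun k hk => ?_).1 ?_⟩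
  · have hneg : k < 0 := not_le.1 fun h => hk ⟨k.toNat, Int.toNat_of_nonneg h⟩
    simp [PowerSeries.coeff_coe, hneg]
  · refine Summable.of_nonneg_of_le
      (fun k => mul_nonneg (norm_nonneg _) (zpow_nonneg hr0.le _)) (fun k => ?_)
      (summable_geometric_of_lt_one (abs_nonneg (B * r)) (hBr.trans_lt one_half_lt_one))
    simp only [Function.comp_apply, HahnSeries.ofPowerSeries_apply_coeff, zpow_natCast]
    calc _ ≤ B ^ k * r ^ k := by gcongr; exact h k
      _ ≤ |B * r| ^ k := by
        rw [← mul_pow, ← abs_pow]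
        exact le_abs_self _

theorem ofPowerSeries_mk_coeff {f : LaurentSeries ℂ} (h : ∀ k < 0, f.coeff k = 0) :
    HahnSeries.ofPowerSeries ℤ ℂ (PowerSeries.mk fun k => f.coeff k) = f := by
  ext k
  rcases lt_or_ge k 0 with hk | hk
  · simp [PowerSeries.coeff_coe, hk, h k hk]
  · lift k to ℕ using hk
    rw [HahnSeries.ofPowerSeries_apply_coeff, PowerSeries.coeff_mk]

theorem formalDilation_ofPowerSeries (a : ℂˣ) (F : PowerSeries ℂ) :
    formalDilation a (HahnSeries.ofPowerSeries ℤ ℂ F) =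
      HahnSeries.ofPowerSeries ℤ ℂ (PowerSeries.rescale (a : ℂ) F) := by
  ext k
  change (a : ℂ) ^ k * (HahnSeries.ofPowerSeries ℤ ℂ F).coeff k = _
  rcases lt_or_ge k 0 with hk | hk
  · simp [PowerSeries.coeff_coe, hk]
  · lift k to ℕ using hk
    simp [HahnSeries.ofPowerSeries_apply_coeff, PowerSeries.coeff_rescale]

theorem exists_root_of_minimal_norm {P : Polynomial ℂ} (hP : 0 < P.degree) :
    ∃ c, P.eval c = 0 ∧ ∀ x, ‖x‖ < ‖c‖ → P.eval x ≠ 0 := by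
  classical
  have hP0 : P ≠ 0 := Polynomial.ne_zero_of_degree_gt hP
  obtain ⟨z, hz⟩ := Complex.exists_root hP
  obtain ⟨c, hc, hmin⟩ := P.roots.toFinset.exists_min_image (fun x => ‖x‖)
    ⟨z, by simpa [hP0] using hz⟩
  simp only [Multiset.mem_toFinset, Polynomial.mem_roots hP0, Polynomial.IsRoot.def] at hc hmin
  exact ⟨c, hc, fun x hx h => (hmin x h).not_gt hx⟩

/-- The exponent `c` is a root of minimal modulus of the characteristic polynomial, so that no
`c p ^ k` with `k > 0` is a root. -/
theorem exists_dilation_solution {p : ℂˣ} (hp : ‖(p : ℂ)‖ < 1) {s : Finset ℕ}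
    {b : ℕ → ConvLaurent} (hb : ∀ i ∈ s, ∀ k < 0, (b i).1.coeff k = 0)
    (h0s : 0 ∈ s) (h0 : (b 0).1.coeff 0 ≠ 0) {j : ℕ} (hjs : j ∈ s) (hj0 : 0 < j)
    (hj : (b j).1.coeff 0 ≠ 0) :
    ∃ (c : ℂˣ) (f : ConvLaurent), f ≠ 0 ∧
      ∑ i ∈ s, b i * (mono 0 (c ^ i : ℂˣ) * dilation (p ^ i) f) = 0 := by
  set β : ℕ → PowerSeries ℂ := fun i => PowerSeries.mk fun k => (b i).1.coeff k
  have hβ : ∀ i ∈ s, HahnSeries.ofPowerSeries ℤ ℂ (β i) = (b i).1 := fun i hi =>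
    ofPowerSeries_mk_coeff (hb i hi)
  have hcoeff : ∀ i ∈ s, (charPoly s β).coeff i = (b i).1.coeff 0 := fun i hi => by
    rw [charPoly_coeff β hi, ← PowerSeries.coeff_zero_eq_constantCoeff_apply, PowerSeries.coeff_mk,
      Nat.cast_zero]
  have heval0 : (charPoly s β).eval 0 ≠ 0 := by
    rwa [← Polynomial.coeff_zero_eq_eval_zero, hcoeff 0 h0s]
  obtain ⟨c, hc, hmin⟩ := exists_root_of_minimal_norm (P := charPoly s β)
    ((Nat.cast_pos.2 hj0).trans_le (Polynomial.le_degree_of_ne_zero (by rwa [hcoeff j hjs])))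
  have hc0 : c ≠ 0 := fun h => heval0 (h ▸ hc)
  obtain ⟨A, R, hA, hR, hAR⟩ := exists_uniform_coeff_bound s b
  obtain ⟨F, hF0, ⟨B, hB⟩, hF⟩ := exists_rescale_solution hp s hA hR
    (fun i hi k => by simpa only [β, PowerSeries.coeff_mk] using hAR i hi k) heval0 hc
    fun k hk => hmin _ (by
      rw [norm_mul, norm_pow]
      exact mul_lt_of_lt_one_right (norm_pos_iff.2 hc0) (pow_lt_one₀ (norm_nonneg _) hp hk.ne'))
  refine ⟨Units.mk0 c hc0, ⟨_, IsConvergent.ofPowerSeries hB⟩, fun h => ?_, Subtype.ext ?_⟩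
  · have hFz := HahnSeries.ofPowerSeries_injective
      ((congrArg Subtype.val h).trans (map_zero (HahnSeries.ofPowerSeries ℤ ℂ)).symm)
    simp [hFz] at hF0
  · refine (map_sum ConvLaurent.subtype _ s).trans ?_
    rw [ZeroMemClass.coe_zero, ← map_zero (HahnSeries.ofPowerSeries ℤ ℂ), ← hF, map_sum]
    refine Finset.sum_congr rfl fun i hi => ?_
    rw [map_mul (HahnSeries.ofPowerSeries ℤ ℂ), map_mul (HahnSeries.ofPowerSeries ℤ ℂ), hβ i hi,
      HahnSeries.ofPowerSeries_C, ← Units.val_pow_eq_pow_val, ← formalDilation_ofPowerSeries]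
    rfl

/-! ### Orders in `K_n` -/

theorem order_eq_of_coeff {f : LaurentSeries ℂ} {k : ℤ} (hk : f.coeff k ≠ 0)
    (h : ∀ j < k, f.coeff j = 0) : f.order = k := by
  refine le_antisymm (HahnSeries.order_le_of_coeff_ne_zero hk) (not_lt.1 fun hlt => ?_)
  exact HahnSeries.coeff_order_eq_zero.not.2 (HahnSeries.ne_zero_of_coeff_ne_zero hk) (h _ hlt)

theorem order_formalDilation (a : ℂˣ) (f : LaurentSeries ℂ) :
    (formalDilation a f).order = f.order := by
  by_cases hf : f = 0
  · simp [hf]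
  refine order_eq_of_coeff ?_ fun j hj => ?_
  · exact mul_ne_zero (zpow_ne_zero _ a.ne_zero) (HahnSeries.coeff_order_eq_zero.not.2 hf)
  · exact mul_eq_zero_of_right _ (HahnSeries.coeff_eq_zero_of_lt_order hj)

theorem order_formalRamification (n : ℕ) [NeZero n] (f : LaurentSeries ℂ) :
    (formalRamification n f).order = n * f.order := by
  by_cases hf : f = 0
  · simp [hf]
  refine order_eq_of_coeff ?_ fun j hj => ?_
  · rw [formalRamification_coeff_mul]
    exact HahnSeries.coeff_order_eq_zero.not.2 hf
  · by_cases hd : (n : ℤ) ∣ j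
    · obtain ⟨k, rfl⟩ := hd
      rw [formalRamification_coeff_mul]
      exact HahnSeries.coeff_eq_zero_of_lt_order
        (lt_of_mul_lt_mul_left hj (Nat.cast_nonneg n))
    · exact formalRamification_coeff_of_not_dvd n f hd

theorem formalRamification_single (n : ℕ) [NeZero n] (t : ℤ) (c : ℂ) :
    formalRamification n (HahnSeries.single t c) = HahnSeries.single (n * t) c :=
  HahnSeries.embDomain_single

namespace KRoot

variable {n : ℕ}

/-- The coefficient of `z^{k/n}` in an element of `K_n`. -/
def coeff (k : ℤ) : KRoot n →+ ℂ where
  toFun f := ((KRoot.equiv n).symm f).1.coeff k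
  map_zero' := rfl
  map_add' _ _ := rfl

/-- The order of an element of `K_n` with respect to the variable `z^{1/n}`. -/
def ord (f : KRoot n) : ℤ := ((KRoot.equiv n).symm f).1.order

theorem ext_coeff {f g : KRoot n} (h : ∀ k, coeff k f = coeff k g) : f = g :=
  (KRoot.equiv n).symm.injective (Subtype.ext (HahnSeries.ext (funext h)))

theorem series_ne_zero {f : KRoot n} (hf : f ≠ 0) : ((KRoot.equiv n).symm f).1 ≠ 0 := fun h =>
  hf ((KRoot.equiv n).symm.injective (Subtype.ext h))

theorem coeff_ord_ne_zero {f : KRoot n} (hf : f ≠ 0) : coeff f.ord f ≠ 0 :=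
  HahnSeries.coeff_order_eq_zero.not.2 (series_ne_zero hf)

theorem coeff_eq_zero_of_lt_ord {f : KRoot n} {k : ℤ} (h : k < f.ord) : coeff k f = 0 :=
  HahnSeries.coeff_eq_zero_of_lt_order h

theorem ord_mul {f g : KRoot n} (hf : f ≠ 0) (hg : g ≠ 0) : (f * g).ord = f.ord + g.ord :=
  HahnSeries.order_mul (series_ne_zero hf) (series_ne_zero hg)

theorem coeff_rootMono_mul (t : ℤ) (c : ℂ) (f : KRoot n) (k : ℤ) :
    coeff k (rootMono n t c * f) = c * coeff (k - t) f :=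
  HahnSeries.coeff_single_mul

theorem rootMono_mul_rootMono (s t : ℤ) (a b : ℂ) :
    rootMono n s a * rootMono n t b = rootMono n (s + t) (a * b) :=
  Subtype.ext HahnSeries.single_mul_single

theorem rootMono_ne_zero (t : ℤ) (c : ℂˣ) : rootMono n t c ≠ 0 := mono_ne_zero t c

theorem ord_rootMono (t : ℤ) (c : ℂˣ) : (rootMono n t c).ord = t :=
  HahnSeries.order_single c.ne_zero

theorem coeff_rootShift (τ : ℂ) (f : KRoot n) (k : ℤ) :
    coeff k (rootShift τ n f) = (qPow τ (1 / n) : ℂ) ^ k * coeff k f := rfl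

theorem rootShift_rootMono (τ : ℂ) (t : ℤ) (c : ℂ) :
    rootShift τ n (rootMono n t c) = rootMono n t ((qPow τ (1 / n) : ℂ) ^ t * c) := by
  refine ext_coeff fun k => ?_
  change _ * (HahnSeries.single t c).coeff k = (HahnSeries.single t _).coeff k
  rcases eq_or_ne k t with rfl | hk
  · simp only [HahnSeries.coeff_single_same]
  · simp only [HahnSeries.coeff_single_of_ne hk, mul_zero]

section Ramified

variable [NeZero n]

theorem coeff_algebraMap_mul (a : ConvLaurent) (k : ℤ) :
    coeff (n * k) (algebraMap ConvLaurent (KRoot n) a) = a.1.coeff k :=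
  formalRamification_coeff_mul n a.1 k

theorem coeff_algebraMap_of_not_dvd (a : ConvLaurent) {k : ℤ} (hk : ¬ (n : ℤ) ∣ k) :
    coeff k (algebraMap ConvLaurent (KRoot n) a) = 0 :=
  formalRamification_coeff_of_not_dvd n a.1 hk

theorem algebraMap_mono (t : ℤ) (c : ℂ) :
    algebraMap ConvLaurent (KRoot n) (mono t c) = rootMono n (n * t) c :=
  Subtype.ext (formalRamification_single n t c)

theorem ord_smul {a : ConvLaurent} (ha : a ≠ 0) {f : KRoot n} (hf : f ≠ 0) :
    (a • f).ord = n * a.1.order + f.ord := by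
  rw [Algebra.smul_def, ord_mul ((map_ne_zero _).2 ha) hf]
  exact congrArg (· + f.ord) (order_formalRamification n a.1)

end Ramified

/-- Otherwise the terms of minimal order could not cancel. -/
theorem exists_ord_eq_of_sum_eq_zero {ι : Type*} {s : Finset ι} {g : ι → KRoot n}
    (hsum : ∑ i ∈ s, g i = 0) (hne : ∃ i ∈ s, g i ≠ 0) :
    ∃ i ∈ s, ∃ j ∈ s, i ≠ j ∧ g i ≠ 0 ∧ g j ≠ 0 ∧ (g i).ord = (g j).ord ∧
      ∀ k ∈ s, g k ≠ 0 → (g i).ord ≤ (g k).ord := by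
  classical
  obtain ⟨i₀, hi₀, h₀⟩ := hne
  obtain ⟨i, hi, hmin⟩ := (s.filter fun i => g i ≠ 0).exists_min_image (fun i => (g i).ord)
    ⟨i₀, Finset.mem_filter.2 ⟨hi₀, h₀⟩⟩
  obtain ⟨his, hgi⟩ := Finset.mem_filter.1 hi
  replace hmin : ∀ k ∈ s, g k ≠ 0 → (g i).ord ≤ (g k).ord := fun k hk h =>
    hmin k (Finset.mem_filter.2 ⟨hk, h⟩)
  by_contra! hcon
  have hcoeff := congrArg (coeff (g i).ord) hsum
  rw [map_sum, map_zero, Finset.sum_eq_single i ?_ fun h => absurd his h] at hcoeff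
  · exact coeff_ord_ne_zero hgi hcoeff
  · intro j hj hji
    by_cases h0 : g j = 0
    · rw [h0, map_zero]
    refine coeff_eq_zero_of_lt_ord ((hmin j hj h0).lt_of_ne fun h => ?_)
    obtain ⟨k, hk, hk0, hlt⟩ := hcon i his j hj hji.symm hgi h0 h
    exact (hmin k hk hk0).not_gt hlt

theorem linearIndependent_of_ord [NeZero n] {ι : Type*} {f : ι → KRoot n} (hf : ∀ i, f i ≠ 0)
    (hord : ∀ i j, (n : ℤ) ∣ (f i).ord - (f j).ord → i = j) :
    LinearIndependent ConvLaurent f := by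
  rw [linearIndependent_iff']
  intro s a hsum
  by_contra! hne
  obtain ⟨i₀, hi₀, ha₀⟩ := hne
  obtain ⟨i, -, j, -, hij, hi, hj, heq, -⟩ := exists_ord_eq_of_sum_eq_zero hsum
    ⟨i₀, hi₀, smul_ne_zero ha₀ (hf i₀)⟩
  rw [ord_smul (left_ne_zero_of_smul hi) (hf i), ord_smul (left_ne_zero_of_smul hj) (hf j)] at heq
  exact hij (hord i j ⟨(a j).1.order - (a i).1.order, by linear_combination heq⟩)

theorem sum_residuePart_smul [NeZero n] (f : KRoot n) :
    ∑ i : Fin n, residuePart n i ((KRoot.equiv n).symm f) • rootMono n (i : ℕ) 1 = f := by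
  refine ext_coeff fun k => ?_
  have hterm : ∀ i : Fin n,
      coeff k (residuePart n i ((KRoot.equiv n).symm f) • rootMono n (i : ℕ) 1) =
        coeff (k - (i : ℕ)) (algebraMap ConvLaurent (KRoot n)
          (residuePart n i ((KRoot.equiv n).symm f))) := fun i => by
    rw [Algebra.smul_def, mul_comm, coeff_rootMono_mul, one_mul]
  rw [map_sum, Finset.sum_congr rfl fun i _ => hterm i]
  have hn : (0 : ℤ) < n := Nat.cast_pos.2 (NeZero.pos n)
  have hk : k = n * (k / n) + k % n := (Int.mul_ediv_add_emod k n).symm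
  have hk0 := Int.emod_nonneg k hn.ne'
  have hkn := Int.emod_lt_of_pos k hn
  lift k % n to ℕ using hk0 with i₀
  rw [Finset.sum_eq_single ⟨i₀, by exact_mod_cast hkn⟩]
  · rw [show k - i₀ = n * (k / n) by omega, coeff_algebraMap_mul]
    exact congrArg (fun j => coeff j f) hk.symm
  · rintro ⟨i, hi⟩ - hne
    refine coeff_algebraMap_of_not_dvd _ fun hd => hne (Fin.ext ?_)
    have hdvd : (n : ℤ) ∣ i₀ - i := by
      have := dvd_sub hd (dvd_mul_right (n : ℤ) (k / n))
      rwa [show k - i - n * (k / n) = i₀ - i by omega] at this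
    have := Int.eq_zero_of_abs_lt_dvd hdvd (by rw [abs_lt]; constructor <;> omega)
    simp only
    omega
  · exact fun h => absurd (Finset.mem_univ _) h

theorem finrank_eq [NeZero n] : Module.finrank ConvLaurent (KRoot n) = n := by
  have hspan : Function.Surjective
      (Fintype.linearCombination ConvLaurent fun i : Fin n => rootMono n (i : ℕ) 1) := fun f =>
    ⟨fun i => residuePart n i ((KRoot.equiv n).symm f), by
      rw [Fintype.linearCombination_apply, sum_residuePart_smul]⟩
  have hord : ∀ i : Fin n, (rootMono n (i : ℕ) 1).ord = (i : ℕ) := fun i => ord_rootMono _ 1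
  have hli : LinearIndependent ConvLaurent fun i : Fin n => rootMono n (i : ℕ) 1 := by
    refine linearIndependent_of_ord (fun i => rootMono_ne_zero _ 1) fun i j h => Fin.ext ?_
    rw [hord, hord] at h
    have := Int.eq_zero_of_abs_lt_dvd h (by rw [abs_lt]; constructor <;> omega)
    omega
  exact le_antisymm (by simpa using LinearMap.finrank_le_finrank_of_surjective hspan)
    (by simpa using hli.fintype_card_le_finrank)

end KRoot

/-! ### Difference modules as modules over `F[Φ, Φ⁻¹]` -/

theorem nonempty_linearEquiv_of_torsionOf_le {R M N : Type*} [Ring R] [AddCommGroup M] [Module R M]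
    [AddCommGroup N] [Module R N] [IsSimpleModule R M] [IsSimpleModule R N] {m : M} {f : N}
    (hm : m ≠ 0) (hf : f ≠ 0) (h : Ideal.torsionOf R M m ≤ Ideal.torsionOf R N f) :
    Nonempty (M ≃ₗ[R] N) := by
  let e := LinearMap.quotKerEquivOfSurjective _ (IsSimpleModule.toSpanSingleton_surjective R hm)
  let g := Submodule.liftQ _ (LinearMap.toSpanSingleton R N f) h
  have hg : g ∘ₗ e.symm.toLinearMap ≠ 0 := fun h0 => hf <| by
    have hgm : g (e.symm (e (Submodule.Quotient.mk 1))) = 0 := DFunLike.congr_fun h0 _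
    rw [e.symm_apply_apply] at hgm
    exact (one_smul R f).symm.trans hgm
  exact ⟨LinearEquiv.ofBijective _ (LinearMap.bijective_of_ne_zero hg)⟩

section Operators

variable {F : Type*} [Field F] {φ : F ≃+* F}

namespace DifferenceModule

variable (M : DifferenceModule.{u} φ)

/-- `Φ` as a unit of the ring of additive endomorphisms, so that all its powers are available. -/
def ΦUnit : (AddMonoid.End M.carrier)ˣ where
  val := M.Φ.toAddMonoidHom
  inv := M.Φ.symm.toAddMonoidHom
  val_inv := AddMonoidHom.ext M.Φ.apply_symm_apply
  inv_val := AddMonoidHom.ext M.Φ.symm_apply_apply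

theorem Φ_symm_smul (a : F) (m : M.carrier) : M.Φ.symm (a • m) = φ.symm a • M.Φ.symm m := by
  rw [AddEquiv.symm_apply_eq, M.Φ_smul, RingEquiv.apply_symm_apply, AddEquiv.apply_symm_apply]

theorem ΦUnit_zpow_smul (k : ℤ) (a : F) (m : M.carrier) :
    (↑(M.ΦUnit ^ k) : AddMonoid.End M.carrier) (a • m) =
      (φ ^ k : RingAut F) a • (↑(M.ΦUnit ^ k) : AddMonoid.End M.carrier) m := by
  induction k generalizing a m with
  | zero => rfl
  | succ k ih =>
    rw [zpow_add_one, zpow_add_one]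
    exact (congrArg _ (M.Φ_smul a m)).trans (ih _ _)
  | pred k ih =>
    rw [zpow_sub_one, zpow_sub_one]
    exact (congrArg (↑(M.ΦUnit ^ (-(k : ℤ))) : AddMonoid.End M.carrier)
      (M.Φ_symm_smul a m)).trans (ih _ _)

/-- The action of `F[Φ, Φ⁻¹]` on a difference module, as a ring homomorphism. -/
def diffOpAction : DiffOp φ →+* AddMonoid.End M.carrier :=
  letI := DiffOp.zAction φ
  SkewMonoidAlgebra.liftNCRingHom (Module.toAddMonoidEnd F M.carrier)
    ((Units.coeHom _).comp (zpowersHom _ M.ΦUnit))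
    fun {a k} => AddMonoidHom.ext fun m => (M.ΦUnit_zpow_smul k.toAdd a m).symm

instance : Module (DiffOp φ) M.carrier := Module.compHom _ M.diffOpAction

variable {M}

theorem term_smul (k : ℤ) (a : F) (m : M.carrier) :
    DiffOp.term φ k a • m = a • (↑(M.ΦUnit ^ k) : AddMonoid.End M.carrier) m := by
  let _ := DiffOp.zAction φ
  exact DFunLike.congr_fun (SkewMonoidAlgebra.liftNC_single
    (Module.toAddMonoidEnd F M.carrier : F →+ AddMonoid.End M.carrier)
    ((Units.coeHom _).comp (zpowersHom _ M.ΦUnit)) (Multiplicative.ofAdd k) a) m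

theorem term_zero_smul (a : F) (m : M.carrier) : DiffOp.term φ 0 a • m = a • m := by
  rw [term_smul]
  rfl

theorem term_one_smul (m : M.carrier) : DiffOp.term φ 1 1 • m = M.Φ m := by
  rw [term_smul, one_smul, zpow_one]
  rfl

theorem term_natCast_smul (i : ℕ) (a : F) (m : M.carrier) :
    DiffOp.term φ i a • m = a • M.Φ^[i] m := by
  rw [term_smul, zpow_natCast, Units.val_pow_eq_pow_val, AddMonoid.End.coe_pow]
  rfl

theorem ofPolynomial_smul (p : Polynomial F) (m : M.carrier) :
    DiffOp.ofPolynomial φ p • m = p.sum fun i a => a • M.Φ^[i] m := by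
  simp only [DiffOp.ofPolynomial, Finset.sum_smul, term_natCast_smul, Polynomial.sum_def]

end DifferenceModule

namespace DiffOp

theorem term_zero_one : term φ 0 1 = 1 := rfl

theorem term_one_mul_term_neg_one : term φ 1 1 * term φ (-1) 1 = 1 := by
  rw [term_mul_term, map_one, mul_one, add_neg_cancel, term_zero_one]

theorem term_neg_one_mul_term_one : term φ (-1) 1 * term φ 1 1 = 1 := by
  rw [term_mul_term, map_one, mul_one, neg_add_cancel, term_zero_one]

theorem induction {P : DiffOp φ → Prop} (scalar : ∀ a, P (term φ 0 a)) (shift : P (term φ 1 1))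
    (shift_inv : P (term φ (-1) 1)) (add : ∀ x y, P x → P y → P (x + y))
    (mul : ∀ x y, P x → P y → P (x * y)) (x : DiffOp φ) : P x := by
  have zpow : ∀ k, P (term φ k 1) := fun k => by
    induction k with
    | zero => exact scalar 1
    | succ k ih => simpa only [term_mul_term, map_one, mul_one] using mul _ _ ih shift
    | pred k ih =>
      simpa only [term_mul_term, map_one, mul_one, ← sub_eq_add_neg] using mul _ _ ih shift_inv
  refine SkewMonoidAlgebra.induction_on (p := P) x ?_ (fun k a => ?_) add
  · simpa only [term, SkewMonoidAlgebra.single_zero] using scalar 0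
  · have h := mul _ _ (scalar a) (zpow k.toAdd)
    rwa [term_mul_term, map_one, mul_one, zero_add] at h

theorem smul_mem_of_stable {A : Type*} [AddCommGroup A] [Module (DiffOp φ) A] (S : AddSubgroup A)
    (scalar : ∀ a, ∀ m ∈ S, term φ 0 a • m ∈ S) (shift : ∀ m ∈ S, term φ 1 1 • m ∈ S)
    (shift_inv : ∀ m ∈ S, term φ (-1) 1 • m ∈ S) (x : DiffOp φ) {m : A} (hm : m ∈ S) :
    x • m ∈ S := by
  suffices h : ∀ m ∈ S, x • m ∈ S from h m hm
  induction x using DiffOp.induction with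
  | scalar a => exact scalar a
  | shift => exact shift
  | shift_inv => exact shift_inv
  | add x y hx hy =>
    intro m hm
    rw [add_smul]
    exact S.add_mem (hx m hm) (hy m hm)
  | mul x y hx hy =>
    intro m hm
    rw [mul_smul]
    exact hx _ (hy m hm)

theorem map_smul_of_commute {A B : Type*} [AddCommGroup A] [Module (DiffOp φ) A] [AddCommGroup B]
    [Module (DiffOp φ) B] (e : A →+ B) (scalar : ∀ a m, e (term φ 0 a • m) = term φ 0 a • e m)
    (shift : ∀ m, e (term φ 1 1 • m) = term φ 1 1 • e m) (x : DiffOp φ) (m : A) :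
    e (x • m) = x • e m := by
  induction x using DiffOp.induction generalizing m with
  | scalar a => exact scalar a m
  | shift => exact shift m
  | shift_inv =>
    have h := shift (term φ (-1) 1 • m)
    rw [smul_smul, term_one_mul_term_neg_one, one_smul] at h
    rw [h, smul_smul, term_neg_one_mul_term_one, one_smul]
  | add x y hx hy => rw [add_smul, add_smul, map_add, hx, hy]
  | mul x y hx hy => rw [mul_smul, mul_smul, hx, hy]

end DiffOp

namespace DifferenceModule

variable {M : DifferenceModule.{u} φ} {N : DifferenceModule.{v} φ}

theorem term_neg_one_smul (m : M.carrier) : DiffOp.term φ (-1) 1 • m = M.Φ.symm m := by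
  rw [term_smul, one_smul, zpow_neg_one]
  rfl

theorem isomorphic_iff : M.Isomorphic N ↔ Nonempty (M.carrier ≃ₗ[DiffOp φ] N.carrier) := by
  constructor
  · rintro ⟨e, he⟩
    exact ⟨{ e with
      map_smul' := DiffOp.map_smul_of_commute (e : M.carrier →+ N.carrier)
        (fun a m => (congrArg e (term_zero_smul a m)).trans
          ((e.map_smul a m).trans (term_zero_smul a _).symm))
        fun m => (congrArg e (term_one_smul m)).trans ((he m).trans (term_one_smul _).symm) }⟩
  · rintro ⟨e⟩
    exact ⟨{ e with
      map_smul' := fun a m => (congrArg e (term_zero_smul a m).symm).trans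
        ((e.map_smul _ m).trans (term_zero_smul a _)) },
      fun m => (congrArg e (term_one_smul m).symm).trans
        ((e.map_smul _ m).trans (term_one_smul _))⟩

/-- The `F[Φ, Φ⁻¹]`-submodule underlying a difference submodule. -/
def toDiffOpSubmodule (N : Submodule F M.carrier) (hN : ∀ m, M.Φ m ∈ N ↔ m ∈ N) :
    Submodule (DiffOp φ) M.carrier where
  __ := N.toAddSubgroup
  smul_mem' x m hm := by
    refine DiffOp.smul_mem_of_stable N.toAddSubgroup (fun a m hm => ?_) (fun m hm => ?_)
      (fun m hm => ?_) x hm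
    · rw [term_zero_smul]
      exact N.smul_mem a hm
    · rw [term_one_smul]
      exact (hN m).2 hm
    · rw [term_neg_one_smul]
      exact (hN _).1 (by rwa [AddEquiv.apply_symm_apply])

/-- The `F`-subspace underlying an `F[Φ, Φ⁻¹]`-submodule of a difference module. -/
def ofDiffOpSubmodule (N : Submodule (DiffOp φ) M.carrier) : Submodule F M.carrier where
  __ := N.toAddSubgroup
  smul_mem' a m hm := term_zero_smul a m ▸ N.smul_mem (DiffOp.term φ 0 a) hm

theorem Φ_mem_ofDiffOpSubmodule (N : Submodule (DiffOp φ) M.carrier) (m : M.carrier) :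
    M.Φ m ∈ ofDiffOpSubmodule N ↔ m ∈ ofDiffOpSubmodule N := by
  refine ⟨fun hm => ?_, fun hm => term_one_smul m ▸ N.smul_mem (DiffOp.term φ 1 1) hm⟩
  have h := N.smul_mem (DiffOp.term φ (-1) 1) hm
  rwa [term_neg_one_smul, AddEquiv.symm_apply_apply] at h

theorem isIrreducible_iff : M.IsIrreducible ↔ IsSimpleModule (DiffOp φ) M.carrier := by
  constructor
  · rintro ⟨_, hM⟩
    refine (isSimpleModule_iff _ _).2
      { exists_pair_ne := ⟨⊥, ⊤, bot_ne_top⟩, eq_bot_or_eq_top := ?_ }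
    exact fun N => (hM _ (Φ_mem_ofDiffOpSubmodule N)).imp
      (fun h => N.eq_bot_iff.2 ((ofDiffOpSubmodule N).eq_bot_iff.1 h))
      fun h : ofDiffOpSubmodule N = ⊤ => Submodule.eq_top_iff'.2 (Submodule.eq_top_iff'.1 h :)
  · intro _
    refine ⟨IsSimpleModule.nontrivial (DiffOp φ) M.carrier, fun N hN => ?_⟩
    exact (eq_bot_or_eq_top (toDiffOpSubmodule N hN)).imp
      (fun h => N.eq_bot_iff.2 ((toDiffOpSubmodule N hN).eq_bot_iff.1 h))
      fun h : toDiffOpSubmodule N hN = ⊤ => Submodule.eq_top_iff'.2 (Submodule.eq_top_iff'.1 h :)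

theorem isPresentedBy_iff {L : DiffOp φ} :
    M.IsPresentedBy L ↔ ∃ m : M.carrier,
      Function.Surjective (LinearMap.toSpanSingleton (DiffOp φ) M.carrier m) ∧
        Ideal.torsionOf (DiffOp φ) M.carrier m = Submodule.span (DiffOp φ) {L} := by
  constructor
  · rintro ⟨e, he₀, he₁⟩
    have he (x : DiffOp φ) : x • e (Submodule.Quotient.mk 1) = e (Submodule.Quotient.mk x) :=
      (DiffOp.map_smul_of_commute (e : _ →+ M.carrier)
        (fun a y => (he₀ a y).trans (term_zero_smul a _).symm)
        (fun y => (he₁ y).trans (term_one_smul _).symm) x _).symm.trans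
      (congrArg (fun y => e (Submodule.Quotient.mk y)) (mul_one x))
    refine ⟨e (Submodule.Quotient.mk 1), fun m => ?_, ?_⟩
    · obtain ⟨x, hx⟩ := Submodule.Quotient.mk_surjective _ (e.symm m)
      exact ⟨x, by rw [LinearMap.toSpanSingleton_apply, he, hx, e.apply_symm_apply]⟩
    · ext x
      rw [Ideal.mem_torsionOf_iff, he, EmbeddingLike.map_eq_zero_iff, Submodule.Quotient.mk_eq_zero]
  · rintro ⟨m, hm, hL⟩
    let e := LinearMap.quotKerEquivOfSurjective _ hm
    rw [IsPresentedBy, ← hL]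
    exact ⟨e.toAddEquiv, fun a x => (e.map_smul _ x).trans (term_zero_smul a _),
      fun x => (e.map_smul _ x).trans (term_one_smul _)⟩

end DifferenceModule

namespace DiffOp

theorem ofPolynomial_add (p r : Polynomial F) :
    ofPolynomial φ (p + r) = ofPolynomial φ p + ofPolynomial φ r :=
  Polynomial.sum_add_index p r _ (fun _ => SkewMonoidAlgebra.single_zero _)
    fun _ _ _ => SkewMonoidAlgebra.single_add _ _ _

theorem ofPolynomial_monomial (i : ℕ) (a : F) :
    ofPolynomial φ (Polynomial.monomial i a) = term φ i a :=
  Polynomial.sum_monomial_index a _ (SkewMonoidAlgebra.single_zero _)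

theorem ofPolynomial_C_mul (a : F) (p : Polynomial F) :
    ofPolynomial φ (.C a * p) = term φ 0 a * ofPolynomial φ p := by
  induction p using Polynomial.induction_on' with
  | add p r hp hr => rw [mul_add, ofPolynomial_add, hp, hr, ofPolynomial_add, mul_add]
  | monomial i b =>
    rw [Polynomial.C_mul_monomial, ofPolynomial_monomial, ofPolynomial_monomial, term_mul_term,
      zero_add]
    rfl

theorem ofPolynomial_X_mul_map (p : Polynomial F) :
    ofPolynomial φ (.X * p.map (φ : F →+* F)) = term φ 1 1 * ofPolynomial φ p := by
  induction p using Polynomial.induction_on' with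
  | add p r hp hr =>
    rw [Polynomial.map_add, mul_add, ofPolynomial_add, hp, hr, ofPolynomial_add, mul_add]
  | monomial i b =>
    rw [Polynomial.map_monomial, Polynomial.X_mul_monomial, ofPolynomial_monomial,
      ofPolynomial_monomial, term_mul_term, one_mul, zpow_one, Nat.cast_succ, add_comm]
    rfl

theorem ofPolynomial_eq_term_one_mul {p : Polynomial F} (hp : p.coeff 0 = 0) :
    ofPolynomial φ p = term φ 1 1 * ofPolynomial φ (p.divX.map (φ.symm : F →+* F)) := by
  have hφ : (φ : F →+* F).comp (φ.symm : F →+* F) = .id F := RingHom.ext φ.apply_symm_apply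
  rw [← ofPolynomial_X_mul_map, Polynomial.map_map, hφ, Polynomial.map_id]
  conv_lhs => rw [← p.X_mul_divX_add, hp, map_zero, add_zero]

theorem ofPolynomial_one : ofPolynomial φ 1 = 1 := ofPolynomial_monomial 0 1

/-- The coefficient of `Φ ^ k` in a difference operator. -/
def coeff (x : DiffOp φ) (k : ℤ) : F := SkewMonoidAlgebra.coeff x (Multiplicative.ofAdd k)

/-- The exponents `k` for which the coefficient of `Φ ^ k` is nonzero. -/
def support (x : DiffOp φ) : Finset ℤ :=
  (SkewMonoidAlgebra.support x).map Multiplicative.toAdd.toEmbedding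

theorem mem_support {x : DiffOp φ} {k : ℤ} : k ∈ x.support ↔ x.coeff k ≠ 0 :=
  Finset.mem_map_equiv.trans SkewMonoidAlgebra.mem_support_iff

theorem support_nonempty {x : DiffOp φ} (hx : x ≠ 0) : x.support.Nonempty :=
  (Finset.nonempty_iff_ne_empty.2 (SkewMonoidAlgebra.support_eq_empty.not.2 hx)).map

theorem coeff_mul (x y : DiffOp φ) (k : ℤ) :
    (x * y).coeff k = ∑ i ∈ x.support, x.coeff i * (φ ^ i : RingAut F) (y.coeff (k - i)) := by
  let _ := zAction φ
  rw [support, Finset.sum_map]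
  refine (SkewMonoidAlgebra.coeff_mul_left (k := F) x y _).trans
    ((SkewMonoidAlgebra.sum_def' (k := F) x _).trans (Finset.sum_congr rfl fun i _ => ?_))
  rw [sub_eq_neg_add]
  rfl

theorem coeff_mul_add {x y : DiffOp φ} {k j : ℤ}
    (h : ∀ i ∈ x.support, i ≠ k → y.coeff (k + j - i) = 0) :
    (x * y).coeff (k + j) = x.coeff k * (φ ^ k : RingAut F) (y.coeff j) := by
  rw [coeff_mul, Finset.sum_eq_single k, add_sub_cancel_left]
  · intro i hi hik
    rw [h i hi hik, map_zero, mul_zero]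
  · intro hk
    rw [not_not.1 (mem_support.not.1 hk), zero_mul]

theorem coeff_ofPolynomial (p : Polynomial F) (k : ℤ) :
    (ofPolynomial φ p).coeff k = if 0 ≤ k then p.coeff k.toNat else 0 := by
  induction p using Polynomial.induction_on' with
  | add p r hp hr =>
    rw [ofPolynomial_add, Polynomial.coeff_add]
    refine (DFunLike.congr_fun (SkewMonoidAlgebra.coeff_add _ _) _).trans
      ((congrArg₂ (· + ·) hp hr).trans ?_)
    split_ifs
    · rfl
    · exact add_zero 0
  | monomial i a =>
    rw [ofPolynomial_monomial, Polynomial.coeff_monomial]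
    refine SkewMonoidAlgebra.coeff_single_apply.trans ?_
    simp only [Multiplicative.ofAdd.apply_eq_iff_eq]
    grind

theorem coeff_ofPolynomial_natCast (p : Polynomial F) (i : ℕ) :
    (ofPolynomial φ p).coeff i = p.coeff i := by
  rw [coeff_ofPolynomial, if_pos i.cast_nonneg, Int.toNat_natCast]

theorem coeff_ofPolynomial_of_natDegree_lt {p : Polynomial F} {k : ℤ} (hk : p.natDegree < k) :
    (ofPolynomial φ p).coeff k = 0 := by
  rw [coeff_ofPolynomial, if_pos (by omega), Polynomial.coeff_eq_zero_of_natDegree_lt (by omega)]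

theorem coeff_ofPolynomial_of_neg {p : Polynomial F} {k : ℤ} (hk : k < 0) :
    (ofPolynomial φ p).coeff k = 0 := by
  rw [coeff_ofPolynomial, if_neg hk.not_ge]

theorem exists_coeff_mul_ofPolynomial_ne_zero {x : DiffOp φ} (hx : x ≠ 0) {p : Polynomial F}
    (hp : p.coeff 0 ≠ 0) : ∃ k l : ℤ, k ≤ l ∧ (x * ofPolynomial φ p).coeff k ≠ 0 ∧
      (x * ofPolynomial φ p).coeff (l + p.natDegree) ≠ 0 := by
  have hφ (k : ℤ) {a : F} (ha : a ≠ 0) : (φ ^ k : RingAut F) a ≠ 0 :=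
    (map_ne_zero_iff _ (RingEquiv.injective _)).2 ha
  have hp' : p.leadingCoeff ≠ 0 := Polynomial.leadingCoeff_ne_zero.2 fun h => hp (by simp [h])
  set k := x.support.min' (support_nonempty hx)
  set l := x.support.max' (support_nonempty hx)
  refine ⟨k + (0 : ℕ), l, ?_, ?_, ?_⟩
  · simpa using x.support.min'_le_max' (support_nonempty hx)
  · rw [coeff_mul_add, coeff_ofPolynomial_natCast]
    · exact mul_ne_zero (mem_support.1 (x.support.min'_mem _)) (hφ k hp)
    · intro i hi hik
      have := x.support.min'_le i hi
      exact coeff_ofPolynomial_of_neg (by omega)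
  · rw [coeff_mul_add, coeff_ofPolynomial_natCast]
    · exact mul_ne_zero (mem_support.1 (x.support.max'_mem _)) (hφ l hp')
    · intro i hi hil
      have := x.support.le_max' i hi
      exact coeff_ofPolynomial_of_natDegree_lt (by omega)

theorem natDegree_le_of_mul_eq_ofPolynomial {x : DiffOp φ} {p r : Polynomial F}
    (hp : p.coeff 0 ≠ 0) (hr : r ≠ 0) (h : x * ofPolynomial φ p = ofPolynomial φ r) :
    p.natDegree ≤ r.natDegree := by
  have hx : x ≠ 0 := by
    rintro rfl
    refine hr (Polynomial.ext fun i => ?_)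
    rw [← coeff_ofPolynomial_natCast (φ := φ), ← h, zero_mul]
    rfl
  obtain ⟨k, l, hkl, hk, hl⟩ := exists_coeff_mul_ofPolynomial_ne_zero hx hp
  rw [h] at hk hl
  have hk0 : 0 ≤ k := by
    by_contra! hneg
    exact hk (coeff_ofPolynomial_of_neg hneg)
  have hld : l + p.natDegree ≤ r.natDegree := by
    by_contra! hlt
    exact hl (coeff_ofPolynomial_of_natDegree_lt hlt)
  omega

theorem ofPolynomial_add_C_mul_smul {A : Type*} [AddCommGroup A] [Module (DiffOp φ) A]
    {p : Polynomial F} {a : A} (ha : ofPolynomial φ p • a = 0) (r : Polynomial F) (c : F) :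
    ofPolynomial φ (r + .C c * p) • a = ofPolynomial φ r • a := by
  rw [ofPolynomial_add, add_smul, ofPolynomial_C_mul, mul_smul, ha, smul_zero, add_zero]

theorem exists_term_one_smul_eq {A : Type*} [AddCommGroup A] [Module (DiffOp φ) A]
    {p : Polynomial F} (hp : p.Monic) {a : A} (ha : ofPolynomial φ p • a = 0)
    {r : Polynomial F} (hr : r.degree < p.natDegree) :
    ∃ s : Polynomial F, s.degree < p.natDegree ∧
      term φ 1 1 • ofPolynomial φ r • a = ofPolynomial φ s • a := by
  set s : Polynomial F := .X * r.map (φ : F →+* F)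
  refine ⟨s + .C (-s.coeff p.natDegree) * p, ?_, ?_⟩
  · rw [Polynomial.degree_lt_iff_coeff_zero] at hr ⊢
    intro i hi
    rw [Polynomial.coeff_add, Polynomial.coeff_C_mul]
    rcases hi.eq_or_lt with rfl | hi
    · rw [hp.coeff_natDegree, mul_one, add_neg_cancel]
    · obtain ⟨i, rfl⟩ := Nat.exists_eq_add_one_of_ne_zero hi.ne_bot
      rw [Polynomial.coeff_X_mul, Polynomial.coeff_map, hr i (by omega), map_zero,
        Polynomial.coeff_eq_zero_of_natDegree_lt hi, mul_zero, add_zero]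
  · rw [ofPolynomial_add_C_mul_smul ha, smul_smul, ofPolynomial_X_mul_map]

theorem exists_term_neg_one_smul_eq {A : Type*} [AddCommGroup A] [Module (DiffOp φ) A]
    {p : Polynomial F} (hp0 : p.coeff 0 ≠ 0) {a : A} (ha : ofPolynomial φ p • a = 0)
    {r : Polynomial F} (hr : r.degree < p.natDegree) :
    ∃ s : Polynomial F, s.degree < p.natDegree ∧
      term φ (-1) 1 • ofPolynomial φ r • a = ofPolynomial φ s • a := by
  set s := r + .C (-r.coeff 0 / p.coeff 0) * p
  have hs0 : s.coeff 0 = 0 := by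
    rw [Polynomial.coeff_add, Polynomial.coeff_C_mul, div_mul_cancel₀ _ hp0, add_neg_cancel]
  refine ⟨s.divX.map (φ.symm : F →+* F), ?_, ?_⟩
  · rw [Polynomial.degree_lt_iff_coeff_zero] at hr ⊢
    intro i hi
    rw [Polynomial.coeff_map, Polynomial.coeff_divX, Polynomial.coeff_add, Polynomial.coeff_C_mul,
      hr (i + 1) (by omega),
      Polynomial.coeff_eq_zero_of_natDegree_lt (p := p) (n := i + 1) (by omega),
      mul_zero, add_zero, map_zero]
  · rw [← ofPolynomial_add_C_mul_smul ha r (-r.coeff 0 / p.coeff 0),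
      ofPolynomial_eq_term_one_mul hs0, smul_smul, ← mul_assoc, term_neg_one_mul_term_one, one_mul]

/-- Division with remainder by `p`, carried out on a vector `a` killed by `p`. -/
theorem exists_degree_lt_smul_eq {A : Type*} [AddCommGroup A] [Module (DiffOp φ) A]
    {p : Polynomial F} (hp : p.Monic) (hp0 : p.coeff 0 ≠ 0) {a : A}
    (ha : ofPolynomial φ p • a = 0) (x : DiffOp φ) :
    ∃ r : Polynomial F, r.degree < p.natDegree ∧ ofPolynomial φ r • a = x • a := by
  let f : Polynomial F →+ A := .mk' (fun r => ofPolynomial φ r • a) fun r s => by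
    rw [ofPolynomial_add, add_smul]
  suffices hx : x • a ∈ (Polynomial.degreeLT F p.natDegree).toAddSubgroup.map f by
    obtain ⟨r, hr, hrx⟩ := hx
    exact ⟨r, Polynomial.mem_degreeLT.1 hr, hrx⟩
  refine smul_mem_of_stable _ ?_ ?_ ?_ x ?_
  · rintro c _ ⟨r, hr, rfl⟩
    refine ⟨.C c * r, ?_, ?_⟩
    · rw [← Polynomial.smul_eq_C_mul]
      exact (Polynomial.degreeLT F p.natDegree).smul_mem c hr
    · exact (congrArg (· • a) (ofPolynomial_C_mul c r)).trans (mul_smul _ _ a)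
  · rintro _ ⟨r, hr, rfl⟩
    obtain ⟨s, hs, h⟩ := exists_term_one_smul_eq hp ha (Polynomial.mem_degreeLT.1 hr)
    exact ⟨s, Polynomial.mem_degreeLT.2 hs, h.symm⟩
  · rintro _ ⟨r, hr, rfl⟩
    obtain ⟨s, hs, h⟩ := exists_term_neg_one_smul_eq hp0 ha (Polynomial.mem_degreeLT.1 hr)
    exact ⟨s, Polynomial.mem_degreeLT.2 hs, h.symm⟩
  · rcases p.natDegree.eq_zero_or_pos with hd | hd
    · rw [hp.natDegree_eq_zero.1 hd, ofPolynomial_one, one_smul] at ha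
      exact ha ▸ AddSubgroup.zero_mem _
    · refine ⟨1, Polynomial.mem_degreeLT.2 ?_, ?_⟩
      · rw [Polynomial.degree_one]
        exact_mod_cast hd
      · exact (congrArg (· • a) ofPolynomial_one).trans (one_smul _ a)

end DiffOp

namespace DifferenceModule

variable {M : DifferenceModule.{u} φ}

theorem exists_ofPolynomial_smul_eq_zero (m : M.carrier) :
    ∃ r : Polynomial F, r ≠ 0 ∧ r.natDegree ≤ Module.finrank F M.carrier ∧
      DiffOp.ofPolynomial φ r • m = 0 := by
  let d := Module.finrank F M.carrier
  let f : Polynomial F →ₗ[F] M.carrier :=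
    Polynomial.lsum fun i => LinearMap.toSpanSingleton F M.carrier (M.Φ^[i] m)
  have hd : Module.finrank F (Polynomial.degreeLT F (d + 1)) = d + 1 := by
    rw [(Polynomial.degreeLTEquiv F (d + 1)).finrank_eq, Module.finrank_fin_fun]
  have _ : Module.Finite F (Polynomial.degreeLT F (d + 1)) :=
    Module.Finite.equiv (Polynomial.degreeLTEquiv F (d + 1)).symm
  obtain ⟨⟨r, hr⟩, hrf, hr0⟩ := Submodule.exists_mem_ne_zero_of_ne_bot
    (LinearMap.ker_ne_bot_of_finrank_lt (f := f.domRestrict (Polynomial.degreeLT F (d + 1)))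
      (by omega))
  have hr0' : r ≠ 0 := fun h => hr0 (Subtype.ext h)
  exact ⟨r, hr0', Nat.lt_add_one_iff.1 ((Polynomial.natDegree_lt_iff_degree_lt hr0').2
    (Polynomial.mem_degreeLT.1 hr)), (ofPolynomial_smul r m).trans hrf⟩

theorem exists_monic_minimal_smul_eq_zero (m : M.carrier) :
    ∃ p : Polynomial F, p.Monic ∧ DiffOp.ofPolynomial φ p • m = 0 ∧
      ∀ r : Polynomial F, r ≠ 0 → DiffOp.ofPolynomial φ r • m = 0 → p.natDegree ≤ r.natDegree := by
  obtain ⟨r, hr, -, hrm⟩ := exists_ofPolynomial_smul_eq_zero m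
  obtain ⟨p, ⟨hp, hpm⟩, hmin⟩ := exists_minimalFor_of_wellFoundedLT
    (fun p : Polynomial F => p ≠ 0 ∧ DiffOp.ofPolynomial φ p • m = 0) Polynomial.natDegree
    ⟨r, hr, hrm⟩
  refine ⟨.C p.leadingCoeff⁻¹ * p, ?_, ?_, fun r hr hrm => ?_⟩
  · exact Polynomial.monic_C_mul_of_mul_leadingCoeff_eq_one
      (inv_mul_cancel₀ (Polynomial.leadingCoeff_ne_zero.2 hp))
  · rw [DiffOp.ofPolynomial_C_mul, mul_smul, hpm, smul_zero]
  · exact (Polynomial.natDegree_C_mul_le _ p).trans ((le_total _ _).elim id (hmin ⟨hr, hrm⟩))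

theorem coeff_zero_ne_zero_of_minimal {m : M.carrier} {p : Polynomial F} (hp : p.Monic)
    (hpm : DiffOp.ofPolynomial φ p • m = 0)
    (hmin : ∀ r : Polynomial F, r ≠ 0 → DiffOp.ofPolynomial φ r • m = 0 →
      p.natDegree ≤ r.natDegree) : p.coeff 0 ≠ 0 := by
  intro h0
  have hd : p.natDegree ≠ 0 := fun hd => by simp [hp.natDegree_eq_zero.1 hd] at h0
  rw [DiffOp.ofPolynomial_eq_term_one_mul h0, mul_smul, term_one_smul,
    EmbeddingLike.map_eq_zero_iff] at hpm
  have hle := hmin _ ?_ hpm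
  · rw [Polynomial.natDegree_map_eq_of_injective φ.symm.injective,
      Polynomial.natDegree_divX_eq_natDegree_tsub_one] at hle
    omega
  · rw [Polynomial.map_ne_zero_iff φ.symm.injective, Ne, Polynomial.divX_eq_zero_iff]
    intro h
    exact hd (h ▸ Polynomial.natDegree_C _)

theorem exists_torsionOf_eq_span (m : M.carrier) :
    ∃ p : Polynomial F, p.Monic ∧ p.coeff 0 ≠ 0 ∧
      Ideal.torsionOf (DiffOp φ) M.carrier m =
        Submodule.span (DiffOp φ) {DiffOp.ofPolynomial φ p} := by
  obtain ⟨p, hp, hpm, hmin⟩ := exists_monic_minimal_smul_eq_zero m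
  have hp0 := coeff_zero_ne_zero_of_minimal hp hpm hmin
  have hle : Submodule.span (DiffOp φ) {DiffOp.ofPolynomial φ p} ≤
      Ideal.torsionOf (DiffOp φ) M.carrier m :=
    (Submodule.span_singleton_le_iff_mem _ _).2 hpm
  refine ⟨p, hp, hp0, le_antisymm (fun x hx => ?_) hle⟩
  set I := Submodule.span (DiffOp φ) {DiffOp.ofPolynomial φ p}
  have hmk (y : DiffOp φ) :
      y • (Submodule.Quotient.mk 1 : DiffOp φ ⧸ I) = Submodule.Quotient.mk y :=
    congrArg Submodule.Quotient.mk (mul_one y)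
  obtain ⟨r, hr, hrx⟩ := DiffOp.exists_degree_lt_smul_eq hp hp0
    (a := (Submodule.Quotient.mk 1 : DiffOp φ ⧸ I))
    (by rw [hmk, Submodule.Quotient.mk_eq_zero]; exact Submodule.mem_span_singleton_self _) x
  rw [hmk, hmk, Submodule.Quotient.eq] at hrx
  have hrm : DiffOp.ofPolynomial φ r • m = 0 := by
    have h := (Ideal.mem_torsionOf_iff m _).1 (hle hrx)
    rwa [sub_smul, (Ideal.mem_torsionOf_iff m _).1 hx, sub_zero] at h
  have hr0 : r = 0 := by
    by_contra hr0
    exact (hmin r hr0 hrm).not_gt ((Polynomial.natDegree_lt_iff_degree_lt hr0).2 hr)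
  rw [hr0] at hrx
  simpa [DiffOp.ofPolynomial] using hrx

theorem natDegree_le_finrank {m : M.carrier} {p : Polynomial F} (hp : p.coeff 0 ≠ 0)
    (h : Ideal.torsionOf (DiffOp φ) M.carrier m =
      Submodule.span (DiffOp φ) {DiffOp.ofPolynomial φ p}) :
    p.natDegree ≤ Module.finrank F M.carrier := by
  obtain ⟨r, hr, hrd, hrm⟩ := exists_ofPolynomial_smul_eq_zero m
  rw [← Ideal.mem_torsionOf_iff, h, Submodule.mem_span_singleton] at hrm
  obtain ⟨x, hx⟩ := hrm
  exact (DiffOp.natDegree_le_of_mul_eq_ofPolynomial hp hr hx).trans hrd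

end DifferenceModule

end Operators

/-! ### Newton polygons -/

theorem le_add_mul_of_mem_newtonPolygon {p : Polynomial ConvLaurent} {b l : ℝ}
    (h : ∀ i, p.coeff i ≠ 0 → b ≤ (p.coeff i).1.order + l * i) {x : ℝ × ℝ}
    (hx : x ∈ newtonPolygon p) : b ≤ x.2 + l * x.1 := by
  have hlin : IsLinearMap ℝ fun x : ℝ × ℝ => x.2 + l * x.1 :=
    (LinearMap.snd ℝ ℝ ℝ + l • LinearMap.fst ℝ ℝ ℝ).isLinear
  refine convexHull_min ?_ (convex_halfSpace_ge hlin b) hx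
  rintro y ⟨i, hi, hy₁, hy₂⟩
  change b ≤ y.2 + l * y.1
  rw [hy₁]
  linarith [h i hi]

theorem fst_mem_Icc_of_mem_newtonPolygon {p : Polynomial ConvLaurent} {x : ℝ × ℝ}
    (hx : x ∈ newtonPolygon p) : x.1 ∈ Set.Icc (0 : ℝ) p.natDegree := by
  refine convexHull_min ?_ ((convex_Icc 0 (p.natDegree : ℝ)).is_linear_preimage
    (LinearMap.fst ℝ ℝ ℝ).isLinear) hx
  rintro y ⟨i, hi, hy, -⟩
  change y.1 ∈ Set.Icc (0 : ℝ) p.natDegree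
  rw [hy]
  exact ⟨i.cast_nonneg, Nat.cast_le.2 (Polynomial.le_natDegree_of_ne_zero hi)⟩

theorem mk_order_mem_newtonPolygon {p : Polynomial ConvLaurent} {i : ℕ} (hi : p.coeff i ≠ 0) :
    ((i : ℝ), ((p.coeff i).1.order : ℝ)) ∈ newtonPolygon p :=
  subset_convexHull ℝ _ ⟨i, hi, rfl, le_rfl⟩

theorem isNewtonSlope_iff {p : Polynomial ConvLaurent} (hd : 0 < p.natDegree)
    (hp0 : p.coeff 0 ≠ 0) {b s : ℝ} (hb : ∀ i, p.coeff i ≠ 0 → b ≤ (p.coeff i).1.order + s * i)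
    (hfirst : (p.coeff 0).1.order = b)
    (hlast : (p.coeff p.natDegree).1.order + s * p.natDegree = b) {l : ℝ} :
    IsNewtonSlope p l ↔ l = s := by
  have hd' : (0 : ℝ) < p.natDegree := Nat.cast_pos.2 hd
  have hleft := mk_order_mem_newtonPolygon hp0
  have hright := mk_order_mem_newtonPolygon (p := p) (i := p.natDegree)
    (Polynomial.leadingCoeff_ne_zero.2 (Polynomial.ne_zero_of_natDegree_gt hd))
  constructor
  · rintro ⟨b', hb', x, ⟨hx, hxb⟩, y, ⟨hy, hyb⟩, hxy⟩
    by_contra hl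
    suffices h : ∃ a, ∀ z ∈ newtonPolygon p, z.2 + l * z.1 = b' → z.1 = a by
      obtain ⟨a, ha⟩ := h
      have hfst : x.1 = y.1 := (ha x hx hxb).trans (ha y hy hyb).symm
      rw [hfst] at hxb
      exact hxy (Prod.ext hfst (by linarith))
    have hfirst_le := hb' _ hleft
    have hlast_le := hb' _ hright
    simp only [Nat.cast_zero, mul_zero, add_zero] at hfirst_le hlast_le
    rcases lt_or_gt_of_ne hl with hl | hl
    · refine ⟨p.natDegree, fun z hz hzb => ?_⟩
      have h := le_add_mul_of_mem_newtonPolygon hb hz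
      exact le_antisymm (fst_mem_Icc_of_mem_newtonPolygon hz).2
        (le_of_mul_le_mul_left (by linarith) (sub_pos.2 hl))
    · refine ⟨0, fun z hz hzb => ?_⟩
      have h := le_add_mul_of_mem_newtonPolygon hb hz
      exact le_antisymm (le_of_mul_le_mul_left (by linarith) (sub_pos.2 hl))
        (fst_mem_Icc_of_mem_newtonPolygon hz).1
  · rintro rfl
    refine ⟨b, fun x hx => le_add_mul_of_mem_newtonPolygon hb hx, _, ⟨hleft, ?_⟩, _,
      ⟨hright, hlast⟩, fun h => hd'.ne' ?_⟩
    · simpa using hfirst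
    · simpa using (congrArg Prod.fst h).symm

theorem isNewtonSlope_iff_eq_div {p : Polynomial ConvLaurent} (hd : 0 < p.natDegree)
    (hp0 : p.coeff 0 ≠ 0) {n : ℕ} [NeZero n] {t : ℤ}
    (hle : ∀ i, p.coeff i ≠ 0 → n * (p.coeff 0).1.order ≤ n * (p.coeff i).1.order + t * i)
    (heq : n * (p.coeff 0).1.order = n * (p.coeff p.natDegree).1.order + t * p.natDegree) {l : ℝ} :
    IsNewtonSlope p l ↔ l = t / n := by
  have hn : (0 : ℝ) < n := Nat.cast_pos.2 (NeZero.pos n)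
  refine isNewtonSlope_iff hd hp0 (fun i hi => ?_) rfl ?_
  · have h : (n : ℝ) * (p.coeff 0).1.order ≤ n * (p.coeff i).1.order + t * i := by
      exact_mod_cast hle i hi
    refine le_of_mul_le_mul_left (h.trans_eq ?_) hn
    field_simp
  · have h : (n : ℝ) * (p.coeff 0).1.order =
        n * (p.coeff p.natDegree).1.order + t * p.natDegree := by exact_mod_cast heq
    refine mul_left_cancel₀ hn.ne' (Eq.trans ?_ h.symm)
    field_simp

theorem exists_first_slope {s : Finset ℕ} (hs : s.Nonempty) (hpos : ∀ i ∈ s, 0 < i) (v : ℕ → ℤ) :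
    ∃ (n : ℕ) (_ : NeZero n) (t : ℤ), IsCoprime t (n : ℤ) ∧
      (∀ i ∈ s, n * v 0 ≤ n * v i + t * i) ∧ ∃ i ∈ s, n * v 0 = n * v i + t * i := by
  obtain ⟨j, hj, hmax⟩ := s.exists_max_image (fun i => ((v 0 - v i : ℤ) : ℚ) / i) hs
  set r : ℚ := ((v 0 - v j : ℤ) : ℚ) / j with hr
  have hden : (0 : ℚ) < r.den := Nat.cast_pos.2 r.den_pos
  refine ⟨r.den, ⟨r.den_nz⟩, r.num, Int.isCoprime_iff_nat_coprime.2 r.reduced, fun i hi => ?_,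
    j, hj, ?_⟩
  · have h := hmax i hi
    replace h := h.trans_eq r.num_div_den.symm
    rw [div_le_div_iff₀ (Nat.cast_pos.2 (hpos i hi)) hden] at h
    have h' : (v 0 - v i) * r.den ≤ r.num * i := by exact_mod_cast h
    linarith
  · have h := r.num_div_den.trans hr
    rw [div_eq_div_iff hden.ne' (Nat.cast_pos.2 (hpos j hj)).ne'] at h
    have h' : r.num * j = (v 0 - v j) * r.den := by exact_mod_cast h
    linarith

/-! ### Powers of `Φ` on `E(c z^{t/n})` -/

section Twist

variable {τ : ℂ} {n : ℕ} {t : ℤ} {c : ℂˣ}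

/-- The additive bijection `f ↦ c z^{t/n} φ(f)` of `K_n`, that is, the operator `Φ` of
`E(c z^{t/n})`; unlike `E`, it does not involve the action of `K`. -/
def twist (τ : ℂ) (n : ℕ) (t : ℤ) (c : ℂˣ) : KRoot n ≃+ KRoot n :=
  (rootShift τ n).toAddEquiv.trans (AddAut.mulRight
    (Units.mk0 (rootMono n t c) (KRoot.rootMono_ne_zero t c)))

theorem twist_apply (f : KRoot n) : twist τ n t c f = rootMono n t c * rootShift τ n f :=
  mul_comm (rootShift τ n f) (rootMono n t c)

theorem rootShift_iterate (f : KRoot n) (i : ℕ) :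
    (rootShift τ n)^[i] f =
      KRoot.equiv n (dilation (qPow τ (1 / n) ^ i) ((KRoot.equiv n).symm f)) := by
  refine KRoot.ext_coeff fun k => ?_
  suffices h : KRoot.coeff k ((rootShift τ n)^[i] f) =
      ((qPow τ (1 / n) ^ i : ℂˣ) : ℂ) ^ k * KRoot.coeff k f from h
  induction i with
  | zero => simp
  | succ i ih =>
    rw [Function.iterate_succ_apply', KRoot.coeff_rootShift, ih, pow_succ', Units.val_mul, mul_zpow,
      mul_assoc]

theorem twist_iterate (f : KRoot n) (i : ℕ) :
    (twist τ n t c)^[i] f =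
      rootMono n (t * i) (c ^ i * qPow τ (1 / n) ^ (t * (i.choose 2 : ℤ)) : ℂˣ) *
        KRoot.equiv n (dilation (qPow τ (1 / n) ^ i) ((KRoot.equiv n).symm f)) := by
  rw [← rootShift_iterate]
  induction i with
  | zero =>
    refine KRoot.ext_coeff fun k => ?_
    rw [KRoot.coeff_rootMono_mul]
    simp
  | succ i ih =>
    rw [Function.iterate_succ_apply', ih, twist_apply, map_mul, KRoot.rootShift_rootMono,
      ← mul_assoc, KRoot.rootMono_mul_rootMono, Function.iterate_succ_apply']
    congr 2
    · push_cast
      ring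
    · rw [Nat.choose_succ_succ' i 1, Nat.choose_one_right]
      push_cast
      rw [mul_add, zpow_add₀ (Units.ne_zero _)]
      ring

theorem ord_twist_iterate {f : KRoot n} (hf : f ≠ 0) (i : ℕ) :
    KRoot.ord ((twist τ n t c)^[i] f) = f.ord + t * i := by
  have hord : (KRoot.equiv n (dilation (qPow τ (1 / n) ^ i) ((KRoot.equiv n).symm f))).ord =
      f.ord := order_formalDilation _ _
  rw [twist_iterate, KRoot.ord_mul (KRoot.rootMono_ne_zero _ _) (by simpa using hf),
    KRoot.ord_rootMono, hord, add_comm]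

theorem twist_iterate_ne_zero {f : KRoot n} (hf : f ≠ 0) (i : ℕ) :
    (twist τ n t c)^[i] f ≠ 0 := by
  rw [twist_iterate]
  exact mul_ne_zero (KRoot.rootMono_ne_zero _ _) (by simpa using hf)

variable [NeZero n]

theorem ord_smul_twist_iterate {a : ConvLaurent} (ha : a ≠ 0) {f : KRoot n} (hf : f ≠ 0) (i : ℕ) :
    (a • (twist τ n t c)^[i] f : KRoot n).ord = n * a.1.order + t * i + f.ord := by
  rw [KRoot.ord_smul ha (twist_iterate_ne_zero hf i), ord_twist_iterate hf]
  ring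

theorem span_twist_iterate (ht : IsCoprime t (n : ℤ)) {f : KRoot n} (hf : f ≠ 0) :
    Submodule.span ConvLaurent (Set.range fun i : Fin n => (twist τ n t c)^[(i : ℕ)] f) = ⊤ := by
  have hli : LinearIndependent ConvLaurent fun i : Fin n => (twist τ n t c)^[(i : ℕ)] f := by
    refine KRoot.linearIndependent_of_ord (fun i => twist_iterate_ne_zero hf i)
      fun i j h => Fin.ext ?_
    rw [ord_twist_iterate hf, ord_twist_iterate hf, add_sub_add_left_eq_sub, ← mul_sub] at h
    have := Int.eq_zero_of_abs_lt_dvd (ht.symm.dvd_of_dvd_mul_left h)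
      (by rw [abs_lt]; constructor <;> omega)
    omega
  exact hli.span_eq_top_of_card_eq_finrank' (by rw [KRoot.finrank_eq, Fintype.card_fin])

/-- Orders modulo `n` show that only the terms of degrees `0` and `n` can have the same order. -/
theorem isNewtonSlope_iff_of_sum_twist_iterate_eq_zero (ht : IsCoprime t (n : ℤ))
    {p : Polynomial ConvLaurent} (hp : p ≠ 0) (hdeg : p.natDegree ≤ n) {f : KRoot n} (hf : f ≠ 0)
    (h : (p.sum fun i a => (a • (twist τ n t c)^[i] f : KRoot n)) = 0) {l : ℝ} :
    IsNewtonSlope p l ↔ l = t / n := by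
  obtain ⟨k, hk⟩ := Polynomial.support_nonempty.2 hp
  obtain ⟨i, hi, j, hj, hij, -, -, hord, hmin⟩ := KRoot.exists_ord_eq_of_sum_eq_zero h
    ⟨k, hk, smul_ne_zero (Polynomial.mem_support_iff.1 hk) (twist_iterate_ne_zero hf k)⟩
  wlog hlt : i < j generalizing i j
  · exact this j hj i hi hij.symm hord.symm (fun k hk h => hord ▸ hmin k hk h) (by omega)
  have hjn : j ≤ p.natDegree := Polynomial.le_natDegree_of_mem_supp j hj
  rw [Polynomial.mem_support_iff] at hi hj
  rw [ord_smul_twist_iterate hi hf] at hord hmin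
  rw [ord_smul_twist_iterate hj hf] at hord
  have hdvd : (n : ℤ) ∣ j - i := ht.symm.dvd_of_dvd_mul_left
    ⟨(p.coeff i).1.order - (p.coeff j).1.order, by linear_combination -hord⟩
  have hle := Int.le_of_dvd (by omega) hdvd
  obtain rfl : i = 0 := by omega
  obtain rfl : j = p.natDegree := by omega
  rw [Nat.cast_zero, mul_zero, add_zero] at hord hmin
  refine isNewtonSlope_iff_eq_div hlt hi (fun k hk => ?_) (by linarith)
  have hk' := hmin k (Polynomial.mem_support_iff.2 hk)
    (smul_ne_zero hk (twist_iterate_ne_zero hf k))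
  rw [ord_smul_twist_iterate hk hf] at hk'
  linarith

end Twist

/-! ### Irreducibility and slopes of `E(c z^{t/n})` -/

namespace E

variable {q : ℂˣ} {τ : ℂ} {hqτ : (q : ℂ) = Complex.exp (2 * Real.pi * Complex.I * τ)}
  {n : ℕ} [NeZero n] {t : ℤ} {c : ℂˣ}

theorem isIrreducible (ht : IsCoprime t (n : ℤ)) : (E q τ hqτ n t c).IsIrreducible := by
  refine ⟨inferInstanceAs (Nontrivial (KRoot n)), fun N hN => or_iff_not_imp_left.2 fun hbot => ?_⟩
  obtain ⟨f, hfN, hf⟩ := N.ne_bot_iff.1 hbot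
  have hmem : ∀ i : ℕ, (E q τ hqτ n t c).Φ^[i] f ∈ N := fun i => by
    induction i with
    | zero => exact hfN
    | succ i ih =>
      rw [Function.iterate_succ_apply']
      exact (hN _).2 ih
  refine eq_top_iff.2 ((span_twist_iterate (τ := τ) (c := c) ht hf).ge.trans
    (Submodule.span_le.2 ?_))
  rintro _ ⟨i, rfl⟩
  exact hmem i

theorem isNewtonSlope_iff_of_torsionOf_eq_span (ht : IsCoprime t (n : ℤ))
    {p : Polynomial ConvLaurent} (hp0 : p.coeff 0 ≠ 0) {m : (E q τ hqτ n t c).carrier}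
    (hm : m ≠ 0) (h : Ideal.torsionOf (DiffOp (dilation q)) (E q τ hqτ n t c).carrier m =
      Submodule.span (DiffOp (dilation q)) {DiffOp.ofPolynomial (dilation q) p}) {l : ℝ} :
    IsNewtonSlope p l ↔ l = t / n := by
  have hpm : DiffOp.ofPolynomial (dilation q) p • m = 0 := by
    rw [← Ideal.mem_torsionOf_iff, h]
    exact Submodule.mem_span_singleton_self _
  rw [DifferenceModule.ofPolynomial_smul] at hpm
  refine isNewtonSlope_iff_of_sum_twist_iterate_eq_zero ht (fun hp => hp0 ?_) ?_ hm hpm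
  · rw [hp, Polynomial.coeff_zero]
  · exact (DifferenceModule.natDegree_le_finrank hp0 h).trans_eq KRoot.finrank_eq

theorem slopes_eq (ht : IsCoprime t (n : ℤ)) : (E q τ hqτ n t c).slopes = {(t : ℝ) / (n : ℝ)} := by
  have := (isIrreducible (hqτ := hqτ) (c := c) ht).1
  have := DifferenceModule.isIrreducible_iff.1 (isIrreducible (hqτ := hqτ) (c := c) ht)
  refine Set.Subset.antisymm ?_ ?_
  · rintro l ⟨p, -, hp0, hpres, hl⟩
    obtain ⟨m, hsurj, htors⟩ := DifferenceModule.isPresentedBy_iff.1 hpres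
    refine (isNewtonSlope_iff_of_torsionOf_eq_span ht hp0 (fun hm => ?_) htors).1 hl
    obtain ⟨x, hx⟩ := exists_ne (0 : (E q τ hqτ n t c).carrier)
    obtain ⟨y, rfl⟩ := hsurj x
    exact hx (by rw [hm, LinearMap.toSpanSingleton_apply, smul_zero])
  · rintro _ rfl
    obtain ⟨m, hm⟩ := exists_ne (0 : (E q τ hqτ n t c).carrier)
    obtain ⟨p, hp, hp0, htors⟩ := DifferenceModule.exists_torsionOf_eq_span m
    exact ⟨p, hp, hp0, DifferenceModule.isPresentedBy_iff.2
      ⟨m, IsSimpleModule.toSpanSingleton_surjective _ hm, htors⟩,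
      (isNewtonSlope_iff_of_torsionOf_eq_span ht hp0 hm htors).2 rfl⟩

end E

/-! ### Isomorphisms between the modules `E(c z^{t/n})` -/

section NormBounds

variable {q : ℂˣ} {τ : ℂ}

theorem qPow_one_div_pow (hqτ : (q : ℂ) = Complex.exp (2 * Real.pi * Complex.I * τ)) (n : ℕ)
    [NeZero n] : qPow τ (1 / n) ^ n = q := by
  have hn : (n : ℂ) ≠ 0 := Nat.cast_ne_zero.2 (NeZero.ne n)
  ext
  rw [hqτ, Units.val_pow_eq_pow_val, qPow, Units.val_mk0, ← Complex.exp_nat_mul]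
  congr 1
  field_simp

theorem norm_qPow_one_div (hqτ : (q : ℂ) = Complex.exp (2 * Real.pi * Complex.I * τ)) (n : ℕ)
    [NeZero n] : ‖(qPow τ (1 / n) : ℂ)‖ = ‖(q : ℂ)‖ ^ (1 / (n : ℝ)) := by
  rw [← qPow_one_div_pow hqτ n, Units.val_pow_eq_pow_val, norm_pow, one_div (n : ℝ),
    Real.pow_rpow_inv_natCast (norm_nonneg _) (NeZero.ne n)]

theorem norm_qPow_one_div_lt_one (hq : ‖(q : ℂ)‖ < 1)
    (hqτ : (q : ℂ) = Complex.exp (2 * Real.pi * Complex.I * τ)) (n : ℕ) [NeZero n] :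
    ‖(qPow τ (1 / n) : ℂ)‖ < 1 := by
  rw [norm_qPow_one_div hqτ]
  exact Real.rpow_lt_one (norm_nonneg _) hq (one_div_pos.2 (Nat.cast_pos.2 (NeZero.pos n)))

theorem IsAdmissible.norm_pow_mem_Ioc {n : ℕ} [NeZero n] {t : ℤ} {c : ℂˣ}
    (h : IsAdmissible q n t c) : ‖(c : ℂ)‖ ^ n ∈ Set.Ioc ‖(q : ℂ)‖ 1 := by
  refine ⟨?_, pow_le_one₀ (norm_nonneg _) h.2.2⟩
  have hlt := pow_lt_pow_left₀ h.2.1 (by positivity) (NeZero.ne n)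
  rwa [one_div, Real.rpow_inv_natCast_pow (norm_nonneg _) (NeZero.ne n)] at hlt

theorem eq_zero_of_zpow_mul_mem_Ioc {r x : ℝ} (hr₀ : 0 < r) (hr₁ : r < 1) {k : ℤ}
    (hx : x ∈ Set.Ioc r 1) (hkx : r ^ k * x ∈ Set.Ioc r 1) : k = 0 := by
  have hrk : 0 < r ^ k := zpow_pos hr₀ k
  have hlt : r ^ (1 : ℤ) < r ^ k := by
    rw [zpow_one]
    exact hkx.1.trans_le (mul_le_of_le_one_right hrk.le hx.2)
  have hgt : r ^ (k + 1) < r ^ (0 : ℤ) := by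
    rw [zpow_zero, zpow_add_one₀ hr₀.ne']
    exact (mul_lt_mul_of_pos_left hx.1 hrk).trans_le hkx.2
  rw [zpow_lt_zpow_iff_right_of_lt_one₀ hr₀ hr₁] at hlt hgt
  omega

end NormBounds

/-- The `K`-automorphism `z^{1/n} ↦ ξ z^{1/n}` of `K_n`, for an `n`-th root of unity `ξ`. -/
def rootRotation (n : ℕ) [NeZero n] (ξ : ℂˣ) (hξ : ξ ^ n = 1) : KRoot n ≃ₐ[ConvLaurent] KRoot n :=
  AlgEquiv.ofRingEquiv
    (f := ((KRoot.equiv n).symm.trans (dilation ξ)).trans (KRoot.equiv n)) fun a => by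
    refine KRoot.ext_coeff fun k => ?_
    change (ξ : ℂ) ^ k * (formalRamification n a.1).coeff k = (formalRamification n a.1).coeff k
    by_cases hk : (n : ℤ) ∣ k
    · obtain ⟨j, rfl⟩ := hk
      rw [zpow_mul, zpow_natCast, ← Units.val_pow_eq_pow_val, hξ, Units.val_one, one_zpow, one_mul]
    · rw [formalRamification_coeff_of_not_dvd n _ hk, mul_zero]

theorem coeff_rootRotation {n : ℕ} [NeZero n] (ξ : ℂˣ) (hξ : ξ ^ n = 1) (f : KRoot n) (k : ℤ) :
    KRoot.coeff k (rootRotation n ξ hξ f) = (ξ : ℂ) ^ k * KRoot.coeff k f := rfl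

theorem exists_zpow_eq_of_isCoprime {G : Type*} [CommGroup G] {n : ℕ} {t : ℤ}
    (ht : IsCoprime t (n : ℤ)) {x : G} (hx : x ^ n = 1) : ∃ y : G, y ^ n = 1 ∧ y ^ t = x := by
  obtain ⟨a, b, hab⟩ := ht
  refine ⟨x ^ a, ?_, ?_⟩
  · rw [← zpow_natCast, zpow_comm, zpow_natCast, hx, one_zpow]
  · rw [← zpow_mul, eq_sub_of_add_eq hab, zpow_sub, zpow_one, mul_comm b, zpow_mul, zpow_natCast,
      hx, one_zpow, inv_one, mul_one]

namespace E

variable {q : ℂˣ} {τ : ℂ} {hqτ : (q : ℂ) = Complex.exp (2 * Real.pi * Complex.I * τ)}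
  {n : ℕ} [NeZero n] {t : ℤ} {c c₁ c₂ : ℂˣ}

theorem isomorphic_mul_zpow (k : ℤ) :
    (E q τ hqτ n t c).Isomorphic (E q τ hqτ n t (c * qPow τ (1 / n) ^ k)) := by
  let m : KRoot n := rootMono n (-k) 1
  have hm : m ≠ 0 := KRoot.rootMono_ne_zero (-k) 1
  refine ⟨LinearEquiv.ofBijective (M := KRoot n) (M₂ := KRoot n)
    (LinearMap.mulLeft ConvLaurent m)
    ⟨mul_right_injective₀ hm, fun g => ⟨m⁻¹ * g, mul_inv_cancel_left₀ hm g⟩⟩, ?_⟩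
  suffices h : ∀ f : KRoot n, m * twist τ n t c f =
      twist τ n t (c * qPow τ (1 / n) ^ k) (m * f) from h
  intro f
  rw [twist_apply, twist_apply, map_mul, KRoot.rootShift_rootMono, ← mul_assoc, ← mul_assoc,
    KRoot.rootMono_mul_rootMono, KRoot.rootMono_mul_rootMono]
  congr 2
  · ring
  · simp only [Units.val_mul, Units.val_zpow_eq_zpow_val, mul_one, one_mul, mul_assoc]
    rw [← zpow_add₀ (Units.ne_zero _), add_neg_cancel, zpow_zero, mul_one]

theorem isomorphic_of_pow_eq (ht : IsCoprime t (n : ℤ)) (h : c₁ ^ n = c₂ ^ n) :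
    (E q τ hqτ n t c₁).Isomorphic (E q τ hqτ n t c₂) := by
  obtain ⟨ξ, hξ, hξt⟩ := exists_zpow_eq_of_isCoprime ht
    (show (c₂ / c₁) ^ n = 1 by rw [div_pow, h, div_self'])
  have hc : (ξ : ℂ) ^ t * c₁ = c₂ := by
    rw [← Units.val_zpow_eq_zpow_val, hξt, ← Units.val_mul, div_mul_cancel]
  refine ⟨(rootRotation n ξ hξ).toLinearEquiv, ?_⟩
  suffices h : ∀ f : KRoot n, rootRotation n ξ hξ (twist τ n t c₁ f) =
      twist τ n t c₂ (rootRotation n ξ hξ f) from h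
  refine fun f => KRoot.ext_coeff fun k => ?_
  rw [coeff_rootRotation, twist_apply, twist_apply, KRoot.coeff_rootMono_mul,
    KRoot.coeff_rootMono_mul, KRoot.coeff_rootShift, KRoot.coeff_rootShift, coeff_rootRotation,
    ← hc, zpow_sub₀ ξ.ne_zero]
  field_simp

/-- On `E(c z^{t/n})` the operator `Φ ^ n` is `f(w) ↦ u c ^ n z ^ t f(q w)`, where `w = z^{1/n}` and
`u` does not depend on `c`; compare the lowest coefficients in `e (Φ ^ n 1) = Φ ^ n (e 1)`. -/
theorem exists_zpow_mul_pow_eq_of_isomorphic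
    (h : (E q τ hqτ n t c₁).Isomorphic (E q τ hqτ n t c₂)) :
    ∃ k : ℤ, q ^ k * c₂ ^ n = c₁ ^ n := by
  obtain ⟨e, he⟩ := h
  let f : KRoot n := e (1 : KRoot n)
  have hf : f ≠ 0 := (map_ne_zero_iff _ e.injective).2 (one_ne_zero (α := KRoot n))
  set u : ℂˣ := qPow τ (1 / n) ^ (t * (n.choose 2 : ℤ))
  have hone : (twist τ n t c₁)^[n] 1 = mono t (c₁ ^ n * u : ℂˣ) • (1 : KRoot n) := by
    rw [twist_iterate, map_one, map_one, map_one, Algebra.smul_def, KRoot.algebraMap_mono,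
      mul_comm t]
  have hiter : mono t (c₁ ^ n * u : ℂˣ) • f = (twist τ n t c₂)^[n] f :=
    (e.map_smul _ (1 : KRoot n)).symm.trans
      ((congrArg e hone).symm.trans (Function.Semiconj.iterate_right (f := e) he n (1 : KRoot n)))
  have hcoeff := congrArg (KRoot.coeff (n * t + f.ord)) hiter
  rw [twist_iterate, qPow_one_div_pow hqτ, Algebra.smul_def, KRoot.algebraMap_mono, mul_comm t,
    KRoot.coeff_rootMono_mul, KRoot.coeff_rootMono_mul, add_sub_cancel_left] at hcoeff
  replace hcoeff : ((c₁ ^ n * u : ℂˣ) : ℂ) * KRoot.coeff f.ord f =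
      (c₂ ^ n * u : ℂˣ) * ((q : ℂ) ^ f.ord * KRoot.coeff f.ord f) := hcoeff
  rw [← mul_assoc, ← Units.val_zpow_eq_zpow_val, ← Units.val_mul] at hcoeff
  have hconst := Units.ext (mul_right_cancel₀ (KRoot.coeff_ord_ne_zero hf) hcoeff)
  refine ⟨f.ord, mul_right_cancel (b := u) ?_⟩
  rw [hconst, mul_comm (q ^ _), mul_right_comm]

theorem isomorphic_iff (hq : ‖(q : ℂ)‖ < 1) (h₁ : IsAdmissible q n t c₁)
    (h₂ : IsAdmissible q n t c₂) :
    (E q τ hqτ n t c₁).Isomorphic (E q τ hqτ n t c₂) ↔ c₁ ^ n = c₂ ^ n := by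
  refine ⟨fun h => ?_, isomorphic_of_pow_eq h₁.1⟩
  obtain ⟨k, hk⟩ := exists_zpow_mul_pow_eq_of_isomorphic h
  have hnorm : ‖(q : ℂ)‖ ^ k * ‖(c₂ : ℂ)‖ ^ n = ‖(c₁ : ℂ)‖ ^ n := by
    simpa using congrArg (fun u : ℂˣ => ‖(u : ℂ)‖) hk
  have hk0 : k = 0 := eq_zero_of_zpow_mul_mem_Ioc (norm_pos_iff.2 q.ne_zero) hq
    h₂.norm_pow_mem_Ioc (hnorm ▸ h₁.norm_pow_mem_Ioc)
  rw [← hk, hk0, zpow_zero, one_mul]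

theorem exists_isAdmissible_isomorphic (hq : ‖(q : ℂ)‖ < 1) (ht : IsCoprime t (n : ℤ)) :
    ∃ c' : ℂˣ, IsAdmissible q n t c' ∧ (E q τ hqτ n t c).Isomorphic (E q τ hqτ n t c') := by
  set p := qPow τ (1 / n) with hp
  have hp₀ : 0 < ‖(p : ℂ)‖ := norm_pos_iff.2 p.ne_zero
  obtain ⟨k, hk₁, hk₂⟩ := exists_mem_Ioc_zpow (norm_pos_iff.2 c.ne_zero)
    ((one_lt_inv₀ hp₀).2 (norm_qPow_one_div_lt_one hq hqτ n))
  rw [inv_zpow'] at hk₁ hk₂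
  refine ⟨c * p ^ (k + 1), ⟨ht, ?_, ?_⟩, isomorphic_mul_zpow _⟩
  · rw [← norm_qPow_one_div hqτ n, ← hp, Units.val_mul, Units.val_zpow_eq_zpow_val, norm_mul,
      norm_zpow]
    calc ‖(p : ℂ)‖ = ‖(p : ℂ)‖ ^ (-k) * ‖(p : ℂ)‖ ^ (k + 1) := by
          rw [← zpow_add₀ hp₀.ne', neg_add_cancel_left, zpow_one]
      _ < ‖(c : ℂ)‖ * ‖(p : ℂ)‖ ^ (k + 1) := by gcongr
  · rw [Units.val_mul, Units.val_zpow_eq_zpow_val, norm_mul, norm_zpow]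
    calc ‖(c : ℂ)‖ * ‖(p : ℂ)‖ ^ (k + 1) ≤ ‖(p : ℂ)‖ ^ (-(k + 1)) * ‖(p : ℂ)‖ ^ (k + 1) := by
          gcongr
      _ = 1 := by rw [← zpow_add₀ hp₀.ne', neg_add_cancel, zpow_zero]

end E

/-! ### Solutions of difference equations in `E(c z^{t/n})` -/

section NormalizedCoeff

variable {τ : ℂ} {n : ℕ} [NeZero n] {t w : ℤ} {i : ℕ} {a : ConvLaurent}

/-- The coefficient of `c ^ i φ ^ i(f)` in `z ^ (-w) (a Φ ^ i)(f)`, for `f` in `E(c z^{t/n})`, as a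
series in the variable `z^{1/n}`. -/
def normalizedCoeff (τ : ℂ) (n : ℕ) [NeZero n] (t w : ℤ) (i : ℕ) (a : ConvLaurent) : ConvLaurent :=
  (KRoot.equiv n).symm (rootMono n (t * i - n * w)
    (qPow τ (1 / n) ^ (t * (i.choose 2 : ℤ)) : ℂˣ) * algebraMap ConvLaurent (KRoot n) a)

theorem smul_twist_iterate_eq (c : ℂˣ) (f : ConvLaurent) :
    a • (twist τ n t c)^[i] (KRoot.equiv n f) = rootMono n (n * w) 1 * KRoot.equiv n
      (normalizedCoeff τ n t w i a * (mono 0 (c ^ i : ℂˣ) * dilation (qPow τ (1 / n) ^ i) f)) := by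
  have hmono : rootMono n (t * i) (c ^ i * qPow τ (1 / n) ^ (t * (i.choose 2 : ℤ)) : ℂˣ) =
      rootMono n (n * w) 1 * (rootMono n (t * i - n * w)
        (qPow τ (1 / n) ^ (t * (i.choose 2 : ℤ)) : ℂˣ) * rootMono n 0 (c ^ i : ℂˣ)) := by
    rw [KRoot.rootMono_mul_rootMono, KRoot.rootMono_mul_rootMono, one_mul, add_zero,
      add_sub_cancel, mul_comm (c ^ i), Units.val_mul]
  rw [twist_iterate, RingEquiv.symm_apply_apply, hmono, Algebra.smul_def, normalizedCoeff,
    map_mul (KRoot.equiv n), map_mul (KRoot.equiv n), RingEquiv.apply_symm_apply]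
  simp only [rootMono]
  ring

theorem order_normalizedCoeff (ha : a ≠ 0) :
    (normalizedCoeff τ n t w i a).1.order = n * a.1.order + t * i - n * w := by
  refine (KRoot.ord_mul (KRoot.rootMono_ne_zero _ _) ((map_ne_zero _).2 ha)).trans ?_
  rw [KRoot.ord_rootMono]
  refine (congrArg (_ + ·) (order_formalRamification n a.1)).trans ?_
  ring

theorem coeff_normalizedCoeff_of_neg (ha : a ≠ 0) (h : n * w ≤ n * a.1.order + t * i) {k : ℤ}
    (hk : k < 0) : (normalizedCoeff τ n t w i a).1.coeff k = 0 := by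
  refine HahnSeries.coeff_eq_zero_of_lt_order ?_
  rw [order_normalizedCoeff ha]
  linarith

theorem coeff_zero_normalizedCoeff_ne_zero (ha : a ≠ 0) (h : n * w = n * a.1.order + t * i) :
    (normalizedCoeff τ n t w i a).1.coeff 0 ≠ 0 := by
  have hne : rootMono n (t * i - n * w) (qPow τ (1 / n) ^ (t * (i.choose 2 : ℤ)) : ℂˣ) *
      algebraMap ConvLaurent (KRoot n) a ≠ 0 :=
    mul_ne_zero (KRoot.rootMono_ne_zero _ _) ((map_ne_zero _).2 ha)
  have hord := order_normalizedCoeff (τ := τ) (n := n) (t := t) (w := w) (i := i) ha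
  rw [← h, sub_self] at hord
  exact hord ▸ KRoot.coeff_ord_ne_zero hne

end NormalizedCoeff

namespace E

variable {q : ℂˣ} {τ : ℂ}

/-- The slope `t / n` is that of the first edge of the Newton polygon of `p`. -/
theorem exists_ofPolynomial_smul_eq_zero (hq : ‖(q : ℂ)‖ < 1)
    (hqτ : (q : ℂ) = Complex.exp (2 * Real.pi * Complex.I * τ)) {p : Polynomial ConvLaurent}
    (hd : 0 < p.natDegree) (hp0 : p.coeff 0 ≠ 0) :
    ∃ (n : ℕ) (_ : NeZero n) (t : ℤ) (c : ℂˣ) (f : (E q τ hqτ n t c).carrier),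
      IsCoprime t (n : ℤ) ∧ f ≠ 0 ∧ DiffOp.ofPolynomial (dilation q) p • f = 0 := by
  set w := (p.coeff 0).1.order
  have hmem {i : ℕ} (hi : i ∈ p.support) : p.coeff i ≠ 0 := Polynomial.mem_support_iff.1 hi
  obtain ⟨n, hn, t, ht, hle, j, hj, heq⟩ := exists_first_slope
    (s := {i ∈ p.support | 0 < i}) ⟨p.natDegree, Finset.mem_filter.2
      ⟨Polynomial.natDegree_mem_support_of_nonzero (Polynomial.ne_zero_of_natDegree_gt hd), hd⟩⟩
    (fun i hi => (Finset.mem_filter.1 hi).2) fun i => (p.coeff i).1.order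
  obtain ⟨hjs, hj0⟩ := Finset.mem_filter.1 hj
  have hle' (i : ℕ) (hi : i ∈ p.support) : n * w ≤ n * (p.coeff i).1.order + t * i := by
    rcases i.eq_zero_or_pos with rfl | hi0
    · simp [w]
    · exact hle i (Finset.mem_filter.2 ⟨hi, hi0⟩)
  obtain ⟨c, f, hf, hsum⟩ := exists_dilation_solution (norm_qPow_one_div_lt_one hq hqτ n)
    (b := fun i => normalizedCoeff τ n t w i (p.coeff i))
    (fun i hi k hk => coeff_normalizedCoeff_of_neg (hmem hi) (hle' i hi) hk)
    (Polynomial.mem_support_iff.2 hp0) (coeff_zero_normalizedCoeff_ne_zero hp0 (by simp [w]))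
    hjs hj0 (coeff_zero_normalizedCoeff_ne_zero (hmem hjs) heq)
  refine ⟨n, hn, t, c, KRoot.equiv n f, ht, (map_ne_zero_iff _ (KRoot.equiv n).injective).2 hf, ?_⟩
  refine (DifferenceModule.ofPolynomial_smul (M := E q τ hqτ n t c) p (KRoot.equiv n f)).trans ?_
  refine (Finset.sum_congr rfl fun i _ => smul_twist_iterate_eq (w := w) c f).trans ?_
  rw [← Finset.mul_sum, ← map_sum, hsum, map_zero]
  exact mul_zero _

theorem exists_isomorphic (hq : ‖(q : ℂ)‖ < 1)
    (hqτ : (q : ℂ) = Complex.exp (2 * Real.pi * Complex.I * τ))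
    {M : DifferenceModule.{u} (dilation q)} (hM : M.IsIrreducible) :
    ∃ (n : ℕ) (_ : NeZero n) (t : ℤ) (c : ℂˣ), IsAdmissible q n t c ∧
      M.Isomorphic (E q τ hqτ n t c) := by
  have := hM.1
  have := DifferenceModule.isIrreducible_iff.1 hM
  obtain ⟨m, hm⟩ := exists_ne (0 : M.carrier)
  obtain ⟨p, hp, hp0, htors⟩ := DifferenceModule.exists_torsionOf_eq_span m
  have hpm : DiffOp.ofPolynomial (dilation q) p • m = 0 := by
    rw [← Ideal.mem_torsionOf_iff, htors]
    exact Submodule.mem_span_singleton_self _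
  have hd : 0 < p.natDegree := Nat.pos_of_ne_zero fun h => hm <| by
    rwa [hp.natDegree_eq_zero.1 h, DiffOp.ofPolynomial_one, one_smul] at hpm
  obtain ⟨n, _, t, c, f, ht, hf, hpf⟩ := exists_ofPolynomial_smul_eq_zero hq hqτ hd hp0
  have := DifferenceModule.isIrreducible_iff.1 (isIrreducible (hqτ := hqτ) (c := c) ht)
  have hle : Ideal.torsionOf (DiffOp (dilation q)) M.carrier m ≤
      Ideal.torsionOf (DiffOp (dilation q)) (E q τ hqτ n t c).carrier f := by
    rw [htors]
    exact (Submodule.span_singleton_le_iff_mem _ _).2 hpf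
  obtain ⟨e⟩ := nonempty_linearEquiv_of_torsionOf_le hm hf hle
  obtain ⟨c', hc', hiso⟩ := exists_isAdmissible_isomorphic (hqτ := hqτ) (c := c) hq ht
  obtain ⟨e'⟩ := DifferenceModule.isomorphic_iff.1 hiso
  exact ⟨n, _, t, c', hc', DifferenceModule.isomorphic_iff.2 ⟨e.trans e'⟩⟩

end E

end QDiff

end

theorem theorem3p4 (q : ℂˣ) (hq : ‖(q : ℂ)‖ < 1) (τ : ℂ) (hτ : 0 < τ.im)
    (hqτ : (q : ℂ) = Complex.exp (2 * Real.pi * Complex.I * τ)) :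
    (∀ (n : ℕ) [NeZero n] (t : ℤ) (c : ℂˣ), QDiff.IsAdmissible q n t c →
      (QDiff.E q τ hqτ n t c).IsPure ∧ (QDiff.E q τ hqτ n t c).IsIrreducible ∧
        (QDiff.E q τ hqτ n t c).slopes = {(t : ℝ) / (n : ℝ)}) ∧
    (∀ (n : ℕ) [NeZero n] (t : ℤ) (c₁ c₂ : ℂˣ),
      QDiff.IsAdmissible q n t c₁ → QDiff.IsAdmissible q n t c₂ →
        ((QDiff.E q τ hqτ n t c₁).Isomorphic (QDiff.E q τ hqτ n t c₂) ↔ c₁ ^ n = c₂ ^ n)) ∧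
    (∀ M : QDiff.DifferenceModule.{u} (QDiff.dilation q), M.IsIrreducible →
      ∃ (n : ℕ) (_ : NeZero n) (t : ℤ) (c : ℂˣ), QDiff.IsAdmissible q n t c ∧
        M.Isomorphic (QDiff.E q τ hqτ n t c)) :=
  ⟨fun _ _ _ _ hadm => ⟨⟨_, QDiff.E.slopes_eq hadm.1⟩, QDiff.E.isIrreducible hadm.1,
      QDiff.E.slopes_eq hadm.1⟩,
    fun _ _ _ _ _ h₁ h₂ => QDiff.E.isomorphic_iff hq h₁ h₂,
    fun _ hM => QDiff.E.exists_isomorphic hq hqτ hM⟩
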